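/- For $k \ge 1$ let $H'_k$ be the graph consisting of four disjoint triangles $A_1, A_2, B_1, B_2$, each with nodes labelled $1,2,3$, together with an edge between the nodes $1$ of $A_1$ and $A_2$, an edge between the nodes $1$ of $B_1$ and $B_2$, and, for each $i \in \{1,2\}$, $k$ internally disjoint paths of length $5$ joining node $2$ of $A_i$ to node $2$ of $B_i$. In the $\mathsf{CONGEST}$ model with bandwidth $b$, the input graph on $n$ nodes is the communication network; nodes have distinct identifiers $1,\dots,n$ and know $n$, their own identifier and those of their neighbours; in each synchronous round every node may send a (possibly different) message of at most $b$ bits to each of its neighbours, and local computation is unlimited. An algorithm solves $H$-detection (induced $H$-detection) in $T$ rounds on a class of graphs if on every input graph $G$ of the class, after $T$ rounds, at least one node accepts if $G$ contains $H$ as a subgraph (as an induced subgraph), and no node accepts otherwise. A randomized algorithm (shared randomness is allowed) has to be correct in this sense with probability at least $2/3$ on every input graph of the class. The degeneracy of a graph is the least $d$ such that every nonempty induced subgraph has a vertex of degree at most $d$. **Theorem.** Let $k \ge 2$. 1. The graph $H'_k$ has treewidth $2$, and there are $c > 0$ and $n_0$, depending only on $k$, such that for all $n \ge n_0$ and all $b$,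 every deterministic or randomized $\mathsf{CONGEST}$ algorithm with bandwidth $b$ that solves $H'_k$-detection or induced $H'_k$-detection on the $n$-node graphs of degeneracy $2$ in $T$ rounds satisfies $b\,T \ge c\, n^{1-1/k}$. In particular, with bandwidth $b = O(\log n)$, it needs $\Omega(n^{1-1/k}/\log n)$ rounds. 2. There is a graph $H_k$ of treewidth $2$ such that every deterministic or randomized $\mathsf{CONGEST}$ algorithm with bandwidth $O(\log n)$ that solves $H_k$-detection or induced $H_k$-detection on graphs of degeneracy $2$ needs $\Omega(n^{1-1/k})$ rounds, where the implied constant depends only on $k$ and the constant in the bandwidth. -/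

import Mathlib

open MeasureTheory
open scoped ENNReal

/-! ## Graph parameters -/

open Classical in
/-- Every nonempty (finite) induced subgraph of `G` has a vertex of degree at most `d`. -/
def IsDegenerate {V : Type*} (G : SimpleGraph V) (d : ℕ) : Prop :=
  ∀ S : Finset V, S.Nonempty → ∃ v ∈ S, (S.filter fun w => G.Adj v w).card ≤ d

/-- The degeneracy of a finite graph: the least `d` such that `G` is `d`-degenerate. -/
noncomputable def degeneracy {V : Type*} (G : SimpleGraph V) : ℕ :=
  sInf {d | IsDegenerate G d}

/-- A tree decomposition of `G`: a tree `tree` on `{0, …, size - 1}` and a bag for each of its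
nodes, such that the bags cover the vertices, each edge lies in a bag, and whenever `j` is on the
path from `i` to `l` in the tree, the bag of `j` contains the intersection of those of
`i` and `l`. -/
structure TreeDecomposition {V : Type*} (G : SimpleGraph V) where
  size : ℕ
  tree : SimpleGraph (Fin size)
  bag : Fin size → Finset V
  isTree : tree.IsTree
  cover_vertex : ∀ v : V, ∃ i, v ∈ bag i
  cover_edge : ∀ u v : V, G.Adj u v → ∃ i, u ∈ bag i ∧ v ∈ bag i
  path_inter : ∀ (i j l : Fin size) (p : tree.Walk i l), p.IsPath → j ∈ p.support →
    ∀ v : V, v ∈ bag i → v ∈ bag l → v ∈ bag j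

/-- The width of a tree decomposition: the maximum size of a bag, minus one. -/
def TreeDecomposition.width {V : Type*} {G : SimpleGraph V} (D : TreeDecomposition G) : ℕ :=
  (Finset.univ.sup fun i => (D.bag i).card) - 1

/-- The treewidth of a finite (nonempty) graph: the least width of a tree decomposition. -/
noncomputable def treewidth {V : Type*} (G : SimpleGraph V) : ℕ :=
  sInf {w | ∃ D : TreeDecomposition G, D.width = w}

/-! ## The pattern graph -/

/-- Vertices of the pattern graph. `Sum.inl (s, i, l)` is the node with label `l` (labels `0, 1, 2`
stand for `1, 2, 3`) of the `i`-th triangle on side `s` (side `0` is `A`, side `1` is `B`).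
`Sum.inr (i, p, q)` is the `q`-th inner node of the `p`-th path joining the `i`-th triangle of
side `A` to the `i`-th triangle of side `B`. -/
abbrev PatternVertex (k : ℕ) : Type :=
  (Fin 2 × Fin 2 × Fin 3) ⊕ (Fin 2 × Fin k × Fin 4)

/-- The edges of the pattern graph, each listed in at least one direction. -/
def patternRel (k : ℕ) : PatternVertex k → PatternVertex k → Prop
  | .inl (s, i, l), .inl (s', i', l') =>
      -- the four triangles
      (s = s' ∧ i = i' ∧ l ≠ l') ∨
      -- an edge between the first nodes of the two triangles of the same side
      (s = s' ∧ i ≠ i' ∧ l = 0 ∧ l' = 0)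
  | .inl (s, i, l), .inr (i', _, q) =>
      -- a path starts in the second node of the triangle of side `A` and
      -- ends in the second node of the triangle of side `B`
      i = i' ∧ l = 1 ∧ ((s = 0 ∧ q = 0) ∨ (s = 1 ∧ q = 3))
  | .inr (i, p, q), .inr (i', p', q') =>
      -- consecutive inner nodes of a path
      i = i' ∧ p = p' ∧ q.val + 1 = q'.val
  | .inr _, .inl _ => False

/-- The pattern graph: triangles `A₁, A₂, B₁, B₂`; the first nodes of `A₁, A₂` are adjacent, so are
the first nodes of `B₁, B₂`; and for `i = 1, 2` the second nodes of `Aᵢ` and `Bᵢ` are joined by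
`k` internally disjoint paths of length `5` (four inner nodes each). -/
def patternGraph (k : ℕ) : SimpleGraph (PatternVertex k) :=
  SimpleGraph.fromRel (patternRel k)

/-! ## The CONGEST model -/

/-- A message of at most `b` bits (the empty message means silence). -/
abbrev Message (b : ℕ) : Type := {l : List Bool // l.length ≤ b}

/-- A deterministic algorithm for networks on `n` nodes with identifiers in `Fin n` and bandwidth
`b`. Nodes know `n`, their identifier and the identifiers of their neighbours, and local
computation is unlimited. In every round each node sends to each of its neighbours a message of at
most `b` bits that may depend on the recipient, and then updates its state from
the messages received. -/
structure CongestAlgorithm (n b : ℕ) where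
  /-- The local states. -/
  State : Type
  /-- The initial state, from the own identifier and the set of identifiers of the neighbours. -/
  init : Fin n → Set (Fin n) → State
  /-- The message sent in a given state to the neighbour with the given identifier. -/
  send : State → Fin n → Message b
  /-- The new state, from the old one and the message received from each neighbour
  (`none` for nodes that are not neighbours). -/
  update : State → (Fin n → Option (Message b)) → State
  /-- Whether a node accepts, that is, reports a yes-instance. -/
  output : State → Bool

open Classical in
/-- The state of each node of the network `G` after `t` rounds. -/
noncomputable def CongestAlgorithm.stateAfter {n b : ℕ} (A : CongestAlgorithm n b)
    (G : SimpleGraph (Fin n)) : ℕ → Fin n → A.State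
  | 0, v => A.init v (G.neighborSet v)
  | t + 1, v => A.update (A.stateAfter G t v) fun u =>
      if G.Adj v u then some (A.send (A.stateAfter G t u) v) else none

/-- After `T` rounds on the network `G`, some node accepts. -/
def CongestAlgorithm.Accepts {n b : ℕ} (A : CongestAlgorithm n b) (T : ℕ)
    (G : SimpleGraph (Fin n)) : Prop :=
  ∃ v, A.output (A.stateAfter G T v) = true

/-- Run for `T` rounds on `G`, the algorithm answers correctly whether `G` has the property `P`:
some node accepts if `G` has it, and no node accepts otherwise. -/
def CongestAlgorithm.CorrectOn {n b : ℕ} (A : CongestAlgorithm n b) (T : ℕ)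
    (P : SimpleGraph (Fin n) → Prop) (G : SimpleGraph (Fin n)) : Prop :=
  A.Accepts T G ↔ P G

/-- A randomized algorithm: a random deterministic algorithm. The randomness is visible to all
nodes; private coins are the case in which `Ω` is a product over the identifiers and each
node uses only its own coordinate. -/
structure RandomizedCongestAlgorithm (n b : ℕ) where
  Ω : Type
  [measurableSpace : MeasurableSpace Ω]
  μ : Measure Ω
  [isProbabilityMeasure : IsProbabilityMeasure μ]
  alg : Ω → CongestAlgorithm n b

/-- Some deterministic algorithm with bandwidth `b` decides in `T` rounds the property `P` on all
`n`-node networks in the class `F`. -/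
def DetSolvable {n : ℕ} (b T : ℕ) (F P : SimpleGraph (Fin n) → Prop) : Prop :=
  ∃ A : CongestAlgorithm n b, ∀ G, F G → A.CorrectOn T P G

/-- Some randomized algorithm with bandwidth `b` decides in `T` rounds the property `P` on all
`n`-node networks in the class `F`, with error probability at most `1/3` on each of them.
(For an event that is not measurable, `μ` is the outer measure, so that
then the error event is covered by a measurable one of probability at most `1/3`.) -/
def RandSolvable {n : ℕ} (b T : ℕ) (F P : SimpleGraph (Fin n) → Prop) : Prop :=
  ∃ A : RandomizedCongestAlgorithm n b, ∀ G, F G →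
    A.μ {ω | ¬ (A.alg ω).CorrectOn T P G} ≤ (1 / 3 : ℝ≥0∞)

/-- With bandwidth `b` and in `T` rounds, some deterministic or randomized algorithm solves
`H`-detection or induced `H`-detection on all `n`-node networks of degeneracy `2`. -/
def DetectableOnDegeneracyTwo {W : Type} (H : SimpleGraph W) (n b T : ℕ) : Prop :=
  DetSolvable (n := n) b T (fun G => degeneracy G = 2) (fun G => H.IsContained G) ∨
  DetSolvable (n := n) b T (fun G => degeneracy G = 2) (fun G => H.IsIndContained G) ∨
  RandSolvable (n := n) b T (fun G => degeneracy G = 2) (fun G => H.IsContained G) ∨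
  RandSolvable (n := n) b T (fun G => degeneracy G = 2) (fun G => H.IsIndContained G)

/-!
The lower bound is a reduction from set disjointness on the universe of words
`w : Fin k → Fin r`, of size `r ^ k`. For each word the host graph has four triangles. The two
triangles of a party are joined by a bridge exactly if the word belongs to the set of this party,
and each triangle is attached to `k` hubs, the letters of the word with their positions. There are
only `4 k r` hubs, and only edges between corresponding hubs of the two parties cross the cut. Since
the triangles of the pattern can only go to triangles of the host graph, and its paths then have to
run through corresponding hubs, a copy of the pattern shows the same word, with its bridges, on both
sides: the pattern occurs if and only if the two sets intersect.

A `T`-round algorithm with bandwidth `b` communicates `O(k r b T)` bits across the cut, while set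
disjointness on `r ^ k` elements costs `Ω(r ^ k)`. Hence `b T = Ω(r ^ (k - 1))` on networks with
`n = Θ(r ^ k)` nodes. The pattern with `k + 1` paths has the exponent `1 - 1 / (k + 1)`, and
the polynomial gain over `1 - 1 / k` absorbs a logarithmic bandwidth.

For the bound on set disjointness, a random subset `d` of the universe is given to one player and
its complement to the other; each player draws a random set inside their part, and then a random
element `i` is put either in both sets or in neither. In a rectangle, the effect of forcing `i`
into the set of one player, summed over `i`, is the correlation of one side of the rectangle with a
sum of independent signs, which is sub-Gaussian. Hence, on average over `i`, a partition into few
rectangles can hardly tell the two cases apart.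
-/

/-! ## Set disjointness: rectangles and a hard distribution -/

section RectanglePartition

variable {X Y τ : Type*}

/-- The combinatorial rectangles `S t ×ˢ U t` partition the set `R` of pairs of inputs. A
deterministic two-party protocol partitions in this way the pairs that it rejects, with one
rectangle for each transcript. -/
structure IsRectanglePartition (S : τ → Set X) (U : τ → Set Y) (R : Set (X × Y)) : Prop where
  pairwise_disjoint : Pairwise fun t t' => Disjoint (S t ×ˢ U t) (S t' ×ˢ U t')
  iUnion_eq : ⋃ t, S t ×ˢ U t = R

theorem IsRectanglePartition.sum_indicator_mul_indicator [Fintype τ] {S : τ → Set X}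
    {U : τ → Set Y} {R : Set (X × Y)} (hR : IsRectanglePartition S U R) (x : X) (y : Y) :
    ∑ t, (S t).indicator (1 : X → ℝ) x * (U t).indicator 1 y = R.indicator 1 (x, y) := by
  have hdisj : (↑(Finset.univ : Finset τ) : Set τ).PairwiseDisjoint fun t => S t ×ˢ U t :=
    fun t _ t' _ hne => hR.pairwise_disjoint hne
  have hunion := Finset.indicator_biUnion (f := (1 : X × Y → ℝ)) Finset.univ _ hdisj
  simp only [Finset.mem_univ, Set.iUnion_true, hR.iUnion_eq] at hunion
  simp only [hunion, Set.indicator_prod_one]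

end RectanglePartition

theorem sum_sum_mul_sum_le {τ α β : Type*} [Fintype τ] [Fintype α] [Fintype β] {f : τ → α → ℝ}
    {g : τ → β → ℝ} (hfg : ∀ x y, ∑ t, f t x * g t y ≤ 1) :
    ∑ t, (∑ x, f t x) * ∑ y, g t y ≤ Fintype.card α * Fintype.card β := by
  simp_rw [Finset.sum_mul_sum]
  rw [Finset.sum_comm]
  simp_rw [Finset.sum_comm (s := (Finset.univ : Finset τ))]
  calc ∑ x, ∑ y, ∑ t, f t x * g t y ≤ ∑ _x : α, ∑ _y : β, (1 : ℝ) := by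
        gcongr with x _ y _
        exact hfg x y
    _ = Fintype.card α * Fintype.card β := by simp

theorem mul_sub_mul_le_max {a₀ a₁ b₀ b₁ : ℝ} (ha₁ : 0 ≤ a₁) (hb₀ : 0 ≤ b₀) (hb₁ : 0 ≤ b₁) :
    a₀ * b₀ - a₁ * b₁ ≤ max (a₀ - a₁) 0 * b₀ + max (b₀ - b₁) 0 * a₀ := by
  rcases le_total a₁ a₀ with h | h <;> rcases le_total b₁ b₀ with h' | h'
  · rw [max_eq_left (by linarith), max_eq_left (by linarith)]
    nlinarith [mul_nonneg (sub_nonneg.2 h) (sub_nonneg.2 h')]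
  · rw [max_eq_left (by linarith), max_eq_right (by linarith)]
    nlinarith [mul_nonneg ha₁ (sub_nonneg.2 h')]
  · rw [max_eq_right (by linarith), max_eq_left (by linarith)]
    nlinarith [mul_nonneg hb₁ (sub_nonneg.2 h)]
  · rw [max_eq_right (by linarith), max_eq_right (by linarith)]
    nlinarith [mul_le_mul h h' hb₀ ha₁]

/-- The sign `(-1) ^ c` of a bit `c`. -/
def bitSign (c : Bool) : ℝ := if c then -1 else 1

section Disjointness

variable {ι : Type*} [DecidableEq ι]

/-- The permutation of the subsets of `ι` that moves the element `i` in or out. -/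
def flipAt (i : ι) : Equiv.Perm (ι → Bool) :=
  Function.Involutive.toPerm (fun d => Function.update d i (!d i)) fun d => by simp

theorem flipAt_self (i : ι) (d : ι → Bool) : flipAt i d i = !d i :=
  Function.update_self ..

theorem flipAt_of_ne {i j : ι} (h : j ≠ i) (d : ι → Bool) : flipAt i d j = d j :=
  Function.update_of_ne h ..

/-- The index set `(d, i, z, w)` of the hard input distribution for set disjointness: the first
player's set is drawn from the subsets of `d`, the second player's from those of the complement of
`d`, and then `i` is put into both sets or into neither of them. -/
abbrev HardSample (ι : Type*) : Type _ :=
  (ι → Bool) × ι × (ι → Bool) × (ι → Bool)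

/-- The two players' sets, where `c` tells whether they share the element `i`. -/
def HardSample.input : HardSample ι → Bool → (ι → Bool) × (ι → Bool)
  | (d, i, z, w), c => (Function.update (z ⊓ d) i c, Function.update (w ⊓ dᶜ) i c)

theorem HardSample.disjoint_input_iff (q : HardSample ι) (c : Bool) :
    Disjoint (q.input c).1 (q.input c).2 ↔ c = false := by
  obtain ⟨d, i, z, w⟩ := q
  rw [HardSample.input, Pi.disjoint_iff]
  simp only [disjoint_iff]
  refine ⟨fun h => by simpa using h i, ?_⟩
  rintro rfl j
  by_cases hj : j = i
  · simp [hj]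
  · cases hd : d j <;> simp [hj, hd]

theorem update_inf_congr (z : ι → Bool) (i : ι) (c : Bool) {d d' : ι → Bool}
    (hd : ∀ j, j ≠ i → d j = d' j) :
    Function.update (z ⊓ d) i c = Function.update (z ⊓ d') i c :=
  Function.update_eq_iff.2 ⟨by simp, fun j hj => by simp [hj, hd j hj]⟩

variable [Fintype ι]

theorem sum_eq_two_mul_sum_filter_of_flipAt (i : ι) {a : (ι → Bool) → ℝ}
    (ha : ∀ d, a (flipAt i d) = a d) : ∑ d, a d = 2 * ∑ d with d i = true, a d := by
  have hfalse : ∑ d with ¬ d i = true, a d = ∑ d with d i = true, a d := by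
    rw [Finset.sum_filter, Finset.sum_filter, ← Equiv.sum_comp (flipAt i)]
    simp only [flipAt_self, ha, Bool.not_eq_true, Bool.not_eq_false']
  rw [← Finset.sum_filter_add_sum_filter_not _ (fun d => d i = true), hfalse, two_mul]

theorem sum_exp_mul_sum_bitSign_le (I : Finset ι) (lam : ℝ) :
    ∑ z : ι → Bool, Real.exp (lam * ∑ i ∈ I, bitSign (z i)) ≤
      Fintype.card (ι → Bool) * Real.exp (Fintype.card ι * (lam ^ 2 / 2)) := by
  have hbit (i : ι) : ∑ c : Bool, Real.exp (if i ∈ I then lam * bitSign c else 0) ≤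
      2 * Real.exp (lam ^ 2 / 2) := by
    have hcosh := Real.cosh_le_exp_half_sq lam
    have hone : 1 ≤ Real.exp (lam ^ 2 / 2) := Real.one_le_exp (by positivity)
    rw [Real.cosh_eq] at hcosh
    by_cases hi : i ∈ I
    · simp only [hi, if_true, Fintype.sum_bool, bitSign, Bool.false_eq_true, if_false, mul_neg,
        mul_one]
      linarith
    · simp only [hi, if_false, Fintype.sum_bool, Real.exp_zero]
      linarith
  calc ∑ z : ι → Bool, Real.exp (lam * ∑ i ∈ I, bitSign (z i))
      = ∑ z : ι → Bool, ∏ i, Real.exp (if i ∈ I then lam * bitSign (z i) else 0) := by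
        refine Finset.sum_congr rfl fun z _ => ?_
        rw [← Real.exp_sum, Finset.mul_sum, ← Finset.sum_filter, Finset.filter_univ_mem]
    _ = ∏ i, ∑ c : Bool, Real.exp (if i ∈ I then lam * bitSign c else 0) :=
        (Fintype.prod_sum fun i c => Real.exp (if i ∈ I then lam * bitSign c else 0)).symm
    _ ≤ ∏ _i : ι, 2 * Real.exp (lam ^ 2 / 2) :=
        Finset.prod_le_prod (fun i _ => by positivity) fun i _ => hbit i
    _ = Fintype.card (ι → Bool) * Real.exp (Fintype.card ι * (lam ^ 2 / 2)) := by
        simp [mul_pow, Real.exp_nat_mul]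

theorem mul_sum_sum_mul_bitSign_le {h : (ι → Bool) → ℝ} (hh : ∀ z, h z ∈ Set.Icc 0 1)
    (I : Finset ι) (lam s : ℝ) :
    lam * ∑ i ∈ I, ∑ z, h z * bitSign (z i) ≤ s * ∑ z, h z +
      Real.exp (-s) * (Fintype.card (ι → Bool) * Real.exp (Fintype.card ι * (lam ^ 2 / 2))) := by
  have hpoint (z : ι → Bool) : h z * (lam * ∑ i ∈ I, bitSign (z i)) ≤
      s * h z + Real.exp (-s) * Real.exp (lam * ∑ i ∈ I, bitSign (z i)) := by
    -- `φ ≤ s + exp (φ - s)`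
    generalize lam * ∑ i ∈ I, bitSign (z i) = φ
    rw [← Real.exp_add]
    have hφ : φ ≤ s + Real.exp (-s + φ) := by linarith [Real.add_one_le_exp (-s + φ)]
    linarith [mul_le_mul_of_nonneg_left hφ (hh z).1,
      mul_le_mul_of_nonneg_right (hh z).2 (Real.exp_pos (-s + φ)).le]
  calc lam * ∑ i ∈ I, ∑ z, h z * bitSign (z i)
      = ∑ z, h z * (lam * ∑ i ∈ I, bitSign (z i)) := by
        rw [Finset.sum_comm, Finset.mul_sum]
        exact Finset.sum_congr rfl fun z _ => by rw [← Finset.mul_sum, mul_left_comm]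
    _ ≤ ∑ z, (s * h z + Real.exp (-s) * Real.exp (lam * ∑ i ∈ I, bitSign (z i))) :=
        Finset.sum_le_sum fun z _ => hpoint z
    _ ≤ _ := by
        rw [Finset.sum_add_distrib, ← Finset.mul_sum, ← Finset.mul_sum]
        gcongr
        exact sum_exp_mul_sum_bitSign_le I lam

/-- The sum of `h` over the subsets of `d`, with the element `i` forced in or out according to
`c`. Every subset of `d` is counted with the same multiplicity. -/
def fixedSum (h : (ι → Bool) → ℝ) (i : ι) (c : Bool) (d : ι → Bool) : ℝ :=
  ∑ z : ι → Bool, h (Function.update (z ⊓ d) i c)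

theorem fixedSum_nonneg {h : (ι → Bool) → ℝ} (h0 : ∀ z, 0 ≤ h z) (i : ι) (c : Bool)
    (d : ι → Bool) : 0 ≤ fixedSum h i c d :=
  Finset.sum_nonneg fun _ _ => h0 _

theorem fixedSum_congr (h : (ι → Bool) → ℝ) (i : ι) (c : Bool) {d d' : ι → Bool}
    (hd : ∀ j, j ≠ i → d j = d' j) : fixedSum h i c d = fixedSum h i c d' :=
  Finset.sum_congr rfl fun z _ => congrArg h (update_inf_congr z i c hd)

theorem fixedSum_flipAt (h : (ι → Bool) → ℝ) (i : ι) (c : Bool) (d : ι → Bool) :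
    fixedSum h i c (flipAt i d) = fixedSum h i c d :=
  fixedSum_congr h i c fun _ hj => flipAt_of_ne hj d

theorem fixedSum_compl_flipAt (h : (ι → Bool) → ℝ) (i : ι) (c : Bool) (d : ι → Bool) :
    fixedSum h i c (flipAt i d)ᶜ = fixedSum h i c dᶜ :=
  fixedSum_congr h i c fun _ hj => congrArg (! ·) (flipAt_of_ne hj d)

theorem fixedSum_false (h : (ι → Bool) → ℝ) {i : ι} {d : ι → Bool} (hd : d i = false) :
    fixedSum h i false d = ∑ z, h (z ⊓ d) :=
  Finset.sum_congr rfl fun z _ => congrArg h <|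
    Function.update_eq_self_iff.2 (by simp [hd])

theorem fixedSum_false_sub_true (h : (ι → Bool) → ℝ) {i : ι} {d : ι → Bool} (hd : d i = true) :
    fixedSum h i false d - fixedSum h i true d = 2 * ∑ z, h (z ⊓ d) * bitSign (z i) := by
  have hself (z : ι → Bool) : Function.update (z ⊓ d) i (z i) = z ⊓ d :=
    Function.update_eq_self_iff.2 (by simp [hd])
  have hflip (z : ι → Bool) : Function.update (z ⊓ d) i (!z i) = flipAt i z ⊓ d := by
    rw [← hself (flipAt i z), flipAt_self]
    exact Function.update_eq_iff.2 ⟨by simp, fun j hj => by simp [hj, flipAt_of_ne hj]⟩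
  have hpair (z : ι → Bool) :
      h (Function.update (z ⊓ d) i false) - h (Function.update (z ⊓ d) i true) =
        h (z ⊓ d) * bitSign (z i) + h (flipAt i z ⊓ d) * bitSign (flipAt i z i) := by
    rw [← hself z, ← hflip, flipAt_self]
    cases z i <;> simp [bitSign] <;> ring
  unfold fixedSum
  rw [← Finset.sum_sub_distrib, Finset.sum_congr rfl fun z _ => hpair z, Finset.sum_add_distrib,
    Equiv.sum_comp (flipAt i) fun z => h (z ⊓ d) * bitSign (z i), two_mul]

theorem mul_sum_max_fixedSum_sub_le {h : (ι → Bool) → ℝ} (hh : ∀ z, h z ∈ Set.Icc 0 1)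
    (d : ι → Bool) (lam s : ℝ) :
    lam * ∑ i with d i = true, max (fixedSum h i false d - fixedSum h i true d) 0 ≤
      2 * (s * ∑ z, h (z ⊓ d) + Real.exp (-s) *
        (Fintype.card (ι → Bool) * Real.exp (Fintype.card ι * (lam ^ 2 / 2)))) := by
  let I : Finset ι := {i | d i = true ∧ 0 ≤ ∑ z, h (z ⊓ d) * bitSign (z i)}
  have hI : ∑ i with d i = true, max (fixedSum h i false d - fixedSum h i true d) 0 =
      2 * ∑ i ∈ I, ∑ z, h (z ⊓ d) * bitSign (z i) := by
    simp only [I]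
    rw [← Finset.filter_filter, Finset.sum_filter (s := Finset.filter _ _), Finset.mul_sum]
    refine Finset.sum_congr rfl fun i hi => ?_
    rw [fixedSum_false_sub_true h (Finset.mem_filter.1 hi).2]
    split_ifs with hpos
    · exact max_eq_left (by linarith)
    · rw [mul_zero, max_eq_right (by linarith)]
  rw [hI, mul_left_comm]
  gcongr
  exact mul_sum_sum_mul_bitSign_le (fun z => hh (z ⊓ d)) I lam s

section Protocol

variable {τ : Type*} [Fintype τ]

section Gap

variable {f g : τ → (ι → Bool) → ℝ} {lam s : ℝ}

theorem sum_filter_sum_max_fixedSum_sub_mul_le (hf : ∀ t x, f t x ∈ Set.Icc 0 1)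
    (hg : ∀ t y, g t y ∈ Set.Icc 0 1) (hfg : ∀ x y, ∑ t, f t x * g t y ≤ 1) (hlam : 0 < lam)
    (hs0 : 0 ≤ s)
    (hs : Fintype.card τ * Real.exp (Fintype.card ι * (lam ^ 2 / 2)) ≤ Real.exp s)
    (d : ι → Bool) :
    ∑ i with d i = true, ∑ t, max (fixedSum (f t) i false d - fixedSum (f t) i true d) 0 *
        fixedSum (g t) i false dᶜ ≤
      (Fintype.card (ι → Bool) : ℝ) ^ 2 * (2 * (s + 1) / lam) := by
  set K : ℝ := ((Fintype.card (ι → Bool) : ℕ) : ℝ) with hK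
  set M : ℝ := Real.exp (Fintype.card ι * (lam ^ 2 / 2))
  set Γ : τ → ℝ := fun t => ∑ w, g t (w ⊓ dᶜ)
  have hΓ0 (t : τ) : 0 ≤ Γ t := Finset.sum_nonneg fun w _ => (hg t _).1
  have hΓK (t : τ) : Γ t ≤ K :=
    (Finset.sum_le_sum fun w _ => (hg t (w ⊓ dᶜ)).2).trans_eq (by simp [hK])
  have hmain : ∑ t, Γ t * ∑ z, f t (z ⊓ d) ≤ K ^ 2 := by
    rw [sq]
    refine sum_sum_mul_sum_le fun w z => ?_
    simpa only [mul_comm] using hfg (z ⊓ d) (w ⊓ dᶜ)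
  have herror : ∑ t, Γ t * (Real.exp (-s) * (K * M)) ≤ K ^ 2 := calc
    ∑ t, Γ t * (Real.exp (-s) * (K * M)) ≤ ∑ _t : τ, K * (Real.exp (-s) * (K * M)) := by
        gcongr with t
        exact hΓK t
    _ = K ^ 2 * (Fintype.card τ * M) * Real.exp (-s) := by
        rw [Finset.sum_const, nsmul_eq_mul, Finset.card_univ]; ring
    _ ≤ K ^ 2 * Real.exp s * Real.exp (-s) := by gcongr
    _ = K ^ 2 := by rw [mul_assoc, ← Real.exp_add, add_neg_cancel, Real.exp_zero, mul_one]
  rw [← mul_div_assoc, le_div_iff₀' hlam, Finset.sum_comm, Finset.mul_sum]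
  calc ∑ t, lam * ∑ i with d i = true,
        max (fixedSum (f t) i false d - fixedSum (f t) i true d) 0 * fixedSum (g t) i false dᶜ
      = ∑ t, Γ t * (lam * ∑ i with d i = true,
          max (fixedSum (f t) i false d - fixedSum (f t) i true d) 0) := by
        refine Finset.sum_congr rfl fun t _ => ?_
        rw [mul_left_comm, mul_comm (Γ t), Finset.sum_mul]
        refine congrArg (lam * ·) (Finset.sum_congr rfl fun i hi => ?_)
        rw [fixedSum_false (g t) (d := dᶜ) (by simp [(Finset.mem_filter.1 hi).2])]
    _ ≤ ∑ t, Γ t * (2 * (s * ∑ z, f t (z ⊓ d) + Real.exp (-s) * (K * M))) :=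
        Finset.sum_le_sum fun t _ =>
          mul_le_mul_of_nonneg_left (mul_sum_max_fixedSum_sub_le (hf t) d lam s) (hΓ0 t)
    _ = 2 * (s * (∑ t, Γ t * ∑ z, f t (z ⊓ d)) + ∑ t, Γ t * (Real.exp (-s) * (K * M))) := by
        rw [Finset.mul_sum _ _ s, ← Finset.sum_add_distrib, Finset.mul_sum]
        exact Finset.sum_congr rfl fun t _ => by ring
    _ ≤ 2 * (s * K ^ 2 + K ^ 2) := by gcongr
    _ = K ^ 2 * (2 * (s + 1)) := by ring

theorem sum_max_fixedSum_sub_mul_le (hf : ∀ t x, f t x ∈ Set.Icc 0 1)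
    (hg : ∀ t y, g t y ∈ Set.Icc 0 1) (hfg : ∀ x y, ∑ t, f t x * g t y ≤ 1) (hlam : 0 < lam)
    (hs0 : 0 ≤ s)
    (hs : Fintype.card τ * Real.exp (Fintype.card ι * (lam ^ 2 / 2)) ≤ Real.exp s) :
    ∑ d : ι → Bool, ∑ i, ∑ t,
        max (fixedSum (f t) i false d - fixedSum (f t) i true d) 0 *
          fixedSum (g t) i false dᶜ ≤
      (Fintype.card (ι → Bool) : ℝ) ^ 3 * (4 * (s + 1) / lam) := by
  let a (i : ι) (d : ι → Bool) : ℝ := ∑ t,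
    max (fixedSum (f t) i false d - fixedSum (f t) i true d) 0 * fixedSum (g t) i false dᶜ
  have hflip (i : ι) (d : ι → Bool) : a i (flipAt i d) = a i d := by
    simp only [a, fixedSum_flipAt, fixedSum_compl_flipAt]
  calc ∑ d, ∑ i, a i d = ∑ i, 2 * ∑ d with d i = true, a i d := by
        rw [Finset.sum_comm]
        exact Finset.sum_congr rfl fun i _ => sum_eq_two_mul_sum_filter_of_flipAt i (hflip i)
    _ = 2 * ∑ d : ι → Bool, ∑ i with d i = true, a i d := by
        simp_rw [← Finset.mul_sum, Finset.sum_filter]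
        rw [Finset.sum_comm]
    _ ≤ 2 * ∑ _d : ι → Bool, (Fintype.card (ι → Bool) : ℝ) ^ 2 * (2 * (s + 1) / lam) := by
        gcongr with d
        exact sum_filter_sum_max_fixedSum_sub_mul_le hf hg hfg hlam hs0 hs d
    _ = (Fintype.card (ι → Bool) : ℝ) ^ 3 * (4 * (s + 1) / lam) := by
        rw [Finset.sum_const, nsmul_eq_mul, Finset.card_univ]; ring

end Gap

theorem IsRectanglePartition.sum_fixedSum_mul_fixedSum {S U : τ → Set (ι → Bool)}
    {R : Set ((ι → Bool) × (ι → Bool))} (hR : IsRectanglePartition S U R) (i : ι) (c : Bool)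
    (d e : ι → Bool) :
    ∑ t, fixedSum ((S t).indicator 1) i c d * fixedSum ((U t).indicator 1) i c e =
      ∑ z, ∑ w, R.indicator 1 (Function.update (z ⊓ d) i c, Function.update (w ⊓ e) i c) := by
  simp_rw [fixedSum, Finset.sum_mul_sum, ← hR.sum_indicator_mul_indicator]
  rw [Finset.sum_comm]
  exact Finset.sum_congr rfl fun z _ => Finset.sum_comm

theorem IsRectanglePartition.sum_input_false_sub_true_le {S U : τ → Set (ι → Bool)}
    {R : Set ((ι → Bool) × (ι → Bool))} (hR : IsRectanglePartition S U R) {lam s : ℝ}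
    (hlam : 0 < lam) (hs0 : 0 ≤ s)
    (hs : Fintype.card τ * Real.exp (Fintype.card ι * (lam ^ 2 / 2)) ≤ Real.exp s) :
    ∑ q : HardSample ι, (R.indicator 1 (q.input false) - R.indicator 1 (q.input true)) ≤
      (Fintype.card (ι → Bool) : ℝ) ^ 3 * (8 * (s + 1) / lam) := by
  let f (t : τ) : (ι → Bool) → ℝ := (S t).indicator 1
  let g (t : τ) : (ι → Bool) → ℝ := (U t).indicator 1
  have hmem (A : Set (ι → Bool)) (x : ι → Bool) :
      A.indicator (1 : (ι → Bool) → ℝ) x ∈ Set.Icc 0 1 :=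
    ⟨Set.indicator_nonneg (fun _ _ => zero_le_one) x,
      Set.indicator_le_self' (fun _ _ => zero_le_one) x⟩
  have hfg (x y : ι → Bool) : ∑ t, f t x * g t y ≤ 1 :=
    (hR.sum_indicator_mul_indicator x y).trans_le
      (Set.indicator_le_self' (fun _ _ => zero_le_one) (x, y))
  have hleft := sum_max_fixedSum_sub_mul_le (fun t => hmem (S t)) (fun t => hmem (U t)) hfg hlam
    hs0 hs
  have hright := sum_max_fixedSum_sub_mul_le (fun t => hmem (U t)) (fun t => hmem (S t))
    (fun x y => by simpa only [mul_comm] using hfg y x) hlam hs0 hs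
  rw [← Equiv.sum_comp (compl_involutive.toPerm _)] at hright
  simp only [Function.Involutive.coe_toPerm, compl_compl] at hright
  calc ∑ q : HardSample ι, (R.indicator 1 (q.input false) - R.indicator 1 (q.input true))
      = ∑ d : ι → Bool, ∑ i, ∑ t, (fixedSum (f t) i false d * fixedSum (g t) i false dᶜ -
          fixedSum (f t) i true d * fixedSum (g t) i true dᶜ) := by
        simp only [Fintype.sum_prod_type, Finset.sum_sub_distrib, HardSample.input, f, g,
          hR.sum_fixedSum_mul_fixedSum]
    _ ≤ ∑ d : ι → Bool, ∑ i, ∑ t,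
          (max (fixedSum (f t) i false d - fixedSum (f t) i true d) 0 *
            fixedSum (g t) i false dᶜ +
          max (fixedSum (g t) i false dᶜ - fixedSum (g t) i true dᶜ) 0 *
            fixedSum (f t) i false d) := by
        gcongr with d _ i _ t _
        exact mul_sub_mul_le_max (fixedSum_nonneg (fun x => (hmem (S t) x).1) _ _ _)
          (fixedSum_nonneg (fun x => (hmem (U t) x).1) _ _ _)
          (fixedSum_nonneg (fun x => (hmem (U t) x).1) _ _ _)
    _ ≤ (Fintype.card (ι → Bool) : ℝ) ^ 3 * (4 * (s + 1) / lam) +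
          (Fintype.card (ι → Bool) : ℝ) ^ 3 * (4 * (s + 1) / lam) := by
        simp only [Finset.sum_add_distrib]
        exact add_le_add hleft hright
    _ = (Fintype.card (ι → Bool) : ℝ) ^ 3 * (8 * (s + 1) / lam) := by ring

open Classical in
theorem card_filter_input_mem_xor_disjoint (R : Set ((ι → Bool) × (ι → Bool))) :
    (({j : Bool × HardSample ι | ¬ (j.2.input j.1 ∈ R ↔
        Disjoint (j.2.input j.1).1 (j.2.input j.1).2)} : Finset _).card : ℝ) =
      Fintype.card (HardSample ι) -
        ∑ q : HardSample ι, (R.indicator 1 (q.input false) - R.indicator 1 (q.input true)) := by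
  simp only [Finset.card_filter, Nat.cast_sum, HardSample.disjoint_input_iff]
  rw [Fintype.sum_prod_type, Fintype.sum_bool, ← Finset.sum_add_distrib, Fintype.card,
    Finset.cast_card, ← Finset.sum_sub_distrib]
  refine Finset.sum_congr rfl fun q _ => ?_
  by_cases hfalse : q.input false ∈ R <;> by_cases htrue : q.input true ∈ R <;>
    simp [hfalse, htrue]

open Classical in
theorem IsRectanglePartition.card_le_log_card {S U : τ → Set (ι → Bool)}
    {R : Set ((ι → Bool) × (ι → Bool))} (hR : IsRectanglePartition S U R)
    (herr : 3 * ({j : Bool × HardSample ι | ¬ (j.2.input j.1 ∈ R ↔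
        Disjoint (j.2.input j.1).1 (j.2.input j.1).2)} : Finset _).card ≤
      Fintype.card (Bool × HardSample ι)) :
    (Fintype.card ι : ℝ) ≤ 1152 * (Real.log (Fintype.card τ) + 1) := by
  set N : ℝ := ((Fintype.card ι : ℕ) : ℝ)
  set K : ℝ := ((Fintype.card (ι → Bool) : ℕ) : ℝ)
  set L : ℝ := Real.log (Fintype.card τ)
  have hL0 : 0 ≤ L := Real.log_natCast_nonneg _
  have hexp : Fintype.card τ * Real.exp (N * ((1 / 24) ^ 2 / 2)) ≤
      Real.exp (L + N * ((1 / 24) ^ 2 / 2)) := by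
    rw [Real.exp_add]
    gcongr
    exact Real.le_exp_log _
  have hgap := hR.sum_input_false_sub_true_le (by norm_num) (by positivity) hexp
  have hcard : (Fintype.card (HardSample ι) : ℝ) = N * K ^ 3 := by
    simp only [HardSample, Fintype.card_prod, Nat.cast_mul]
    ring
  have hcount : 3 * (N * K ^ 3 - ∑ q : HardSample ι,
      (R.indicator 1 (q.input false) - R.indicator 1 (q.input true))) ≤ 2 * (N * K ^ 3) := by
    rw [← hcard, ← card_filter_input_mem_xor_disjoint]
    rw [Fintype.card_prod, Fintype.card_bool] at herr
    exact_mod_cast herr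
  have hK : 0 < K := by simp only [K]; positivity
  have hN : N ≤ 3 * (8 * (L + N * ((1 / 24) ^ 2 / 2) + 1) / (1 / 24)) :=
    le_of_mul_le_mul_right (by linarith) (pow_pos hK 3)
  linarith

end Protocol

end Disjointness

/-! ## Two-party simulation of CONGEST algorithms -/

instance finite_message (b : ℕ) : Finite (Message b) :=
  (List.finite_length_le Bool b).to_subtype

theorem natCard_message_le (b : ℕ) : Nat.card (Message b) ≤ 3 ^ b := by
  let code (l : Message b) (i : Fin b) : Option Bool := l.1[i.val]?
  have hcode : Function.Injective code := fun l l' h => Subtype.ext <| List.ext_getElem? fun i => by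
    by_cases hi : i < b
    · exact congrFun h ⟨i, hi⟩
    · rw [List.getElem?_eq_none (by have := l.2; omega),
        List.getElem?_eq_none (by have := l'.2; omega)]
  simpa using Nat.card_le_card_of_injective code hcode

theorem log_natCard_message_le (b : ℕ) : Real.log (Nat.card (Message b)) ≤ 2 * b := by
  have : Nonempty (Message b) := ⟨⟨[], Nat.zero_le b⟩⟩
  have hlog : Real.log 3 ≤ 2 := by
    linarith [Real.log_le_sub_one_of_pos (show (0 : ℝ) < 3 by norm_num)]
  calc Real.log (Nat.card (Message b)) ≤ Real.log (3 ^ b) :=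
        Real.log_le_log (by exact_mod_cast Nat.card_pos) (by exact_mod_cast natCard_message_le b)
    _ = b * Real.log 3 := Real.log_pow ..
    _ ≤ 2 * b := by nlinarith [(Nat.cast_nonneg b : (0 : ℝ) ≤ b)]

namespace CongestAlgorithm

variable {n b : ℕ} (A : CongestAlgorithm n b)

theorem not_accepts_iff {T : ℕ} {G : SimpleGraph (Fin n)} :
    ¬ A.Accepts T G ↔ ∀ v, A.output (A.stateAfter G T v) = false := by
  simp [Accepts]

theorem stateAfter_succ_congr {G H : SimpleGraph (Fin n)} {t : ℕ} {v : Fin n}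
    (hadj : ∀ u, H.Adj v u ↔ G.Adj v u) (hstate : A.stateAfter H t v = A.stateAfter G t v)
    (hsend : ∀ u, H.Adj v u → A.send (A.stateAfter H t u) v = A.send (A.stateAfter G t u) v) :
    A.stateAfter H (t + 1) v = A.stateAfter G (t + 1) v := by
  simp only [stateAfter, hstate]
  refine congrArg _ (funext fun u => ?_)
  by_cases hu : H.Adj v u
  · rw [if_pos hu, if_pos ((hadj u).1 hu), hsend u hu]
  · rw [if_neg hu, if_neg (mt (hadj u).2 hu)]

/-- The messages that the algorithm sends on the network `G` in the first `T` rounds along the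
ordered pairs of nodes in `cut`. A pair of nodes that is not an edge of `G` is not exempt: its entry
is the message that the first node would send. -/
noncomputable def transcript (T : ℕ) (cut : Finset (Fin n × Fin n)) (G : SimpleGraph (Fin n)) :
    Fin T × cut → Message b :=
  fun p => A.send (A.stateAfter G p.1 p.2.1.1) p.2.1.2

theorem stateAfter_hybrid_succ {cut : Finset (Fin n × Fin n)} {G G' H : SimpleGraph (Fin n)}
    {s : Set (Fin n)} {t : ℕ} (hG : ∀ v ∈ s, ∀ u, H.Adj v u ↔ G.Adj v u)
    (hcut : ∀ u v, H.Adj u v → (u ∈ s ↔ v ∉ s) → (u, v) ∈ cut)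
    (hsend : ∀ p ∈ cut, A.send (A.stateAfter G' t p.1) p.2 = A.send (A.stateAfter G t p.1) p.2)
    (hs : ∀ v ∈ s, A.stateAfter H t v = A.stateAfter G t v)
    (hs' : ∀ v ∉ s, A.stateAfter H t v = A.stateAfter G' t v) {v : Fin n} (hv : v ∈ s) :
    A.stateAfter H (t + 1) v = A.stateAfter G (t + 1) v := by
  refine A.stateAfter_succ_congr (hG v hv) (hs v hv) fun u hadj => ?_
  by_cases hu : u ∈ s
  · rw [hs u hu]
  · rw [hs' u hu, hsend (u, v) (hcut u v hadj.symm (by tauto))]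

theorem stateAfter_hybrid {T : ℕ} {cut : Finset (Fin n × Fin n)} {G G' H : SimpleGraph (Fin n)}
    {s : Set (Fin n)} (hG : ∀ v ∈ s, ∀ u, H.Adj v u ↔ G.Adj v u)
    (hG' : ∀ v ∉ s, ∀ u, H.Adj v u ↔ G'.Adj v u)
    (hcut : ∀ u v, H.Adj u v → (u ∈ s ↔ v ∉ s) → (u, v) ∈ cut)
    (htr : A.transcript T cut G = A.transcript T cut G') {t : ℕ} (ht : t ≤ T) :
    (∀ v ∈ s, A.stateAfter H t v = A.stateAfter G t v) ∧
      ∀ v ∉ s, A.stateAfter H t v = A.stateAfter G' t v := by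
  induction t with
  | zero =>
    exact ⟨fun v hv => congrArg (A.init v) (Set.ext (hG v hv)),
      fun v hv => congrArg (A.init v) (Set.ext (hG' v hv))⟩
  | succ t ih =>
    obtain ⟨ihs, ihs'⟩ := ih (by omega)
    have hsend (p) (hp : p ∈ cut) :
        A.send (A.stateAfter G t p.1) p.2 = A.send (A.stateAfter G' t p.1) p.2 :=
      congrFun htr (⟨t, ht⟩, ⟨p, hp⟩)
    refine ⟨fun v => A.stateAfter_hybrid_succ hG hcut (fun p hp => (hsend p hp).symm) ihs ihs',
      fun v hv => ?_⟩
    refine A.stateAfter_hybrid_succ (s := sᶜ) (cut := cut) hG' (fun u w hadj hiff => ?_) hsend ihs'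
      (fun v hv => ihs v (Set.notMem_compl_iff.1 hv)) hv
    exact hcut u w hadj (by simp only [Set.mem_compl_iff] at hiff; tauto)

theorem transcript_hybrid {T : ℕ} {cut : Finset (Fin n × Fin n)} {G G' H : SimpleGraph (Fin n)}
    {s : Set (Fin n)} (hG : ∀ v ∈ s, ∀ u, H.Adj v u ↔ G.Adj v u)
    (hG' : ∀ v ∉ s, ∀ u, H.Adj v u ↔ G'.Adj v u)
    (hcut : ∀ u v, H.Adj u v → (u ∈ s ↔ v ∉ s) → (u, v) ∈ cut)
    (htr : A.transcript T cut G = A.transcript T cut G') :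
    A.transcript T cut H = A.transcript T cut G := by
  funext p
  obtain ⟨hs, hs'⟩ := A.stateAfter_hybrid hG hG' hcut htr p.1.2.le
  by_cases hp : p.2.1.1 ∈ s
  · simp only [transcript, hs _ hp]
  · rw [htr]
    simp only [transcript, hs' _ hp]

end CongestAlgorithm

/-- A family of networks on `n` nodes, indexed by the inputs of two players, in which the first
player's input determines the neighbourhoods of the nodes in `side`, the second player's input
determines those of the other nodes, and `cut` contains both orientations of all the edges between
the two sides. -/
structure TwoPartyNetwork (X Y : Type*) (n : ℕ) where
  graph : X → Y → SimpleGraph (Fin n)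
  side : Set (Fin n)
  cut : Finset (Fin n × Fin n)
  adj_left (x : X) (y y' : Y) : ∀ v ∈ side, ∀ u, (graph x y).Adj v u ↔ (graph x y').Adj v u
  adj_right (x x' : X) (y : Y) : ∀ v ∉ side, ∀ u, (graph x y).Adj v u ↔ (graph x' y).Adj v u
  mem_cut (x : X) (y : Y) :
    ∀ u v, (graph x y).Adj u v → (u ∈ side ↔ v ∉ side) → (u, v) ∈ cut

namespace TwoPartyNetwork

variable {X Y : Type*} {n b : ℕ} (N : TwoPartyNetwork X Y n)

/-- The inputs `x` for which, with some input of the second player, the cut carries the messages `m`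
and the nodes of the first player do not accept. -/
def leftRectangle (A : CongestAlgorithm n b) (T : ℕ) (m : Fin T × N.cut → Message b) : Set X :=
  {x | ∃ y, A.transcript T N.cut (N.graph x y) = m ∧
    ∀ v ∈ N.side, A.output (A.stateAfter (N.graph x y) T v) = false}

/-- The counterpart of `TwoPartyNetwork.leftRectangle` for the second player. -/
def rightRectangle (A : CongestAlgorithm n b) (T : ℕ) (m : Fin T × N.cut → Message b) : Set Y :=
  {y | ∃ x, A.transcript T N.cut (N.graph x y) = m ∧
    ∀ v ∉ N.side, A.output (A.stateAfter (N.graph x y) T v) = false}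

theorem transcript_eq_of_mem_rectangles {A : CongestAlgorithm n b} {T : ℕ}
    {m : Fin T × N.cut → Message b} {x : X} {y : Y} (hx : x ∈ N.leftRectangle A T m)
    (hy : y ∈ N.rightRectangle A T m) :
    A.transcript T N.cut (N.graph x y) = m ∧ ¬ A.Accepts T (N.graph x y) := by
  obtain ⟨y', hm, hout⟩ := hx
  obtain ⟨x', hm', hout'⟩ := hy
  have hG := N.adj_left x y y'
  have hG' := N.adj_right x x' y
  have htr := hm.trans hm'.symm
  obtain ⟨hs, hs'⟩ := A.stateAfter_hybrid hG hG' (N.mem_cut x y) htr le_rfl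
  refine ⟨(A.transcript_hybrid hG hG' (N.mem_cut x y) htr).trans hm,
    A.not_accepts_iff.2 fun v => ?_⟩
  by_cases hv : v ∈ N.side
  · rw [hs v hv, hout v hv]
  · rw [hs' v hv, hout' v hv]

theorem isRectanglePartition (A : CongestAlgorithm n b) (T : ℕ) :
    IsRectanglePartition (N.leftRectangle A T) (N.rightRectangle A T)
      {p | ¬ A.Accepts T (N.graph p.1 p.2)} where
  pairwise_disjoint m m' hne := Set.disjoint_left.2 fun _ hp hp' => hne <|
    (N.transcript_eq_of_mem_rectangles hp.1 hp.2).1.symm.trans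
      (N.transcript_eq_of_mem_rectangles hp'.1 hp'.2).1
  iUnion_eq := by
    ext ⟨x, y⟩
    rw [Set.mem_iUnion]
    refine ⟨fun ⟨m, hx, hy⟩ => (N.transcript_eq_of_mem_rectangles hx hy).2, fun h => ?_⟩
    have hout := A.not_accepts_iff.1 h
    exact ⟨_, ⟨y, rfl, fun v _ => hout v⟩, ⟨x, rfl, fun v _ => hout v⟩⟩

end TwoPartyNetwork

theorem log_natCard_transcript_le {n : ℕ} (b T : ℕ) (cut : Finset (Fin n × Fin n)) :
    Real.log (Nat.card (Fin T × cut → Message b)) ≤ 2 * cut.card * (b * T) := by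
  rw [Nat.card_fun, Nat.cast_pow, Real.log_pow, Nat.card_eq_fintype_card, Fintype.card_prod,
    Fintype.card_fin, Fintype.card_coe]
  calc ((T * cut.card : ℕ) : ℝ) * Real.log (Nat.card (Message b))
      ≤ ((T * cut.card : ℕ) : ℝ) * (2 * b) := by
        gcongr
        exact log_natCard_message_le b
    _ = 2 * cut.card * (b * T) := by push_cast; ring

theorem DetSolvable.randSolvable {n b T : ℕ} {F P : SimpleGraph (Fin n) → Prop}
    (h : DetSolvable b T F P) : RandSolvable b T F P := by
  obtain ⟨A, hA⟩ := h
  exact ⟨{ Ω := Unit, μ := Measure.dirac (), alg := fun _ => A }, fun G hG => by simp [hA G hG]⟩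

open Classical in
theorem exists_card_filter_mem_le {Ω J : Type*} [MeasurableSpace Ω] [Fintype J] (μ : Measure Ω)
    [IsProbabilityMeasure μ] {E : J → Set Ω} {p : ℝ≥0∞} (hE : ∀ j, μ (E j) ≤ p) :
    ∃ ω, (({j | ω ∈ E j} : Finset J).card : ℝ≥0∞) ≤ Fintype.card J * p := by
  let E' (j : J) : Set Ω := toMeasurable μ (E j)
  have hE' (j : J) : MeasurableSet (E' j) := measurableSet_toMeasurable _ _
  have hmeas (j : J) : Measurable ((E' j).indicator (1 : Ω → ℝ≥0∞)) :=
    measurable_one.indicator (hE' j)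
  obtain ⟨ω, hω⟩ := exists_le_lintegral (μ := μ)
    (Finset.measurable_fun_sum Finset.univ fun j _ => hmeas j).aemeasurable
  refine ⟨ω, ?_⟩
  calc (({j | ω ∈ E j} : Finset J).card : ℝ≥0∞) = ∑ j, (E j).indicator 1 ω := by
        simp [Set.indicator_apply]
    _ ≤ ∑ j, (E' j).indicator 1 ω := by
        gcongr with j
        exact subset_toMeasurable μ (E j)
    _ ≤ ∑ j, μ (E j) := by
        simpa only [lintegral_finsetSum _ fun j _ => hmeas j, lintegral_indicator_one (hE' _), E',
          measure_toMeasurable] using hω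
    _ ≤ ∑ _j : J, p := Finset.sum_le_sum fun j _ => hE j
    _ = Fintype.card J * p := by simp

open Classical in
theorem RandSolvable.exists_three_mul_card_le {n b T : ℕ} {F P : SimpleGraph (Fin n) → Prop}
    (h : RandSolvable b T F P) {J : Type*} [Fintype J] {G : J → SimpleGraph (Fin n)}
    (hG : ∀ j, F (G j)) : ∃ A : CongestAlgorithm n b,
      3 * ({j | ¬ A.CorrectOn T P (G j)} : Finset J).card ≤ Fintype.card J := by
  obtain ⟨A, hA⟩ := h
  let _ := A.measurableSpace
  have := A.isProbabilityMeasure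
  obtain ⟨ω, hω⟩ := exists_card_filter_mem_le A.μ fun j => hA (G j) (hG j)
  refine ⟨A.alg ω, ?_⟩
  simp only [Set.mem_ofPred_eq] at hω
  rw [mul_one_div, ENNReal.le_div_iff_mul_le (by simp) (by simp), mul_comm] at hω
  exact_mod_cast hω

theorem TwoPartyNetwork.card_le_of_randSolvable {n b T : ℕ} {ι : Type*} [Fintype ι]
    (N : TwoPartyNetwork (ι → Bool) (ι → Bool) n) {F P : SimpleGraph (Fin n) → Prop}
    (hF : ∀ x y, F (N.graph x y)) (hP : ∀ x y, P (N.graph x y) ↔ ¬ Disjoint x y)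
    (h : RandSolvable b T F P) :
    (Fintype.card ι : ℝ) ≤ 1152 * (2 * N.cut.card * (b * T) + 1) := by
  classical
  obtain ⟨A, hA⟩ := h.exists_three_mul_card_le (J := Bool × HardSample ι)
    (G := fun j => N.graph (j.2.input j.1).1 (j.2.input j.1).2) fun j => hF _ _
  have := Fintype.ofFinite (Fin T × N.cut → Message b)
  have hcard := (N.isRectanglePartition A T).card_le_log_card (by
    simpa only [CongestAlgorithm.CorrectOn, hP, Set.mem_ofPred_eq, not_iff, not_iff_not,
      not_not] using hA)
  have hlog := log_natCard_transcript_le b T N.cut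
  rw [Nat.card_eq_fintype_card] at hlog
  linarith

/-! ## Treewidth -/

section Trees

variable {ι : Type*} {T : SimpleGraph ι}

theorem isPath_append {i j l : ι} {p : T.Walk i j} {q : T.Walk j l} (hp : p.IsPath)
    (hq : q.IsPath) (h : ∀ m ∈ p.support, m ∈ q.support → m = j) : (p.append q).IsPath := by
  rw [SimpleGraph.Walk.isPath_def, SimpleGraph.Walk.support_append, List.nodup_append']
  refine ⟨hp.support_nodup, hq.support_nodup.tail, fun m hm hm' => ?_⟩
  have hj : j ∉ q.support.tail := by
    have hnodup := hq.support_nodup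
    rw [← SimpleGraph.Walk.cons_tail_support, List.nodup_cons] at hnodup
    exact hnodup.1
  exact hj (h m hm (List.mem_of_mem_tail hm') ▸ hm')

theorem exists_median_of_connected (hT : T.Connected) (i j l : ι) :
    ∃ (m : ι) (p : T.Walk i j) (q : T.Walk l i) (q' : T.Walk l j),
      (p.IsPath ∧ m ∈ p.support) ∧ (q.IsPath ∧ m ∈ q.support) ∧ (q'.IsPath ∧ m ∈ q'.support) := by
  classical
  obtain ⟨p, hp⟩ := (hT.preconnected i j).exists_isPath
  obtain ⟨w, hw⟩ := (hT.preconnected l i).exists_isPath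
  obtain ⟨m, hmp, hmw, hfirst⟩ := w.exists_mem_support_forall_mem_support_imp_eq p.support.toFinset
    ⟨i, by simp⟩
  rw [List.mem_toFinset] at hmp
  simp only [List.mem_toFinset] at hfirst
  have hstart := hw.takeUntil hmw
  refine ⟨m, p, (w.takeUntil m hmw).append (p.takeUntil m hmp).reverse,
    (w.takeUntil m hmw).append (p.dropUntil m hmp), ⟨hp, hmp⟩,
    ⟨isPath_append hstart (hp.takeUntil hmp).reverse fun x hx hx' => ?_, by simp⟩,
    ⟨isPath_append hstart (hp.dropUntil hmp) fun x hx hx' => ?_, by simp⟩⟩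
  · rw [SimpleGraph.Walk.support_reverse, List.mem_reverse] at hx'
    exact hfirst x (p.support_takeUntil_subset_support hmp hx') hx
  · exact hfirst x (p.support_dropUntil_subset_support hmp hx') hx

theorem support_subset_of_isAcyclic (hT : T.IsAcyclic) {i j : ι} {p : T.Walk i j} (hp : p.IsPath)
    (q : T.Walk i j) : p.support ⊆ q.support := by
  classical
  have hpq : p = q.bypass := congrArg Subtype.val
    ((hT.subsingleton_path i j).elim ⟨p, hp⟩ ⟨q.bypass, q.bypass_isPath⟩)
  exact hpq ▸ q.support_bypass_subset_support

theorem exists_walk_of_parent {P : ι → Prop} {f : ι → ι} {ρ : ι → ℕ} {t : ι}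
    (hclimb : ∀ i, P i → i ≠ t → T.Adj i (f i) ∧ ρ (f i) < ρ i ∧ P (f i)) (i : ι) (hi : P i) :
    ∃ p : T.Walk i t, ∀ j ∈ p.support, P j := by
  induction hn : ρ i using Nat.strong_induction_on generalizing i with
  | _ n ih =>
    obtain rfl | hit := eq_or_ne i t
    · exact ⟨.nil, by simpa using hi⟩
    · obtain ⟨hadj, hlt, hfi⟩ := hclimb i hi hit
      obtain ⟨p, hp⟩ := ih _ (hn ▸ hlt) (f i) hfi rfl
      exact ⟨.cons hadj p, by simpa [hi] using hp⟩

/-- The graph on the nodes of a rooted tree in which each node `i` other than the root `r` is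
joined to its parent `f i`. It is a tree once some rank decreases from each node to its parent. -/
def parentTree (r : ι) (f : ι → ι) : SimpleGraph ι :=
  SimpleGraph.fromRel fun i j => i ≠ r ∧ j = f i

variable {r : ι} {f : ι → ι} {ρ : ι → ℕ}

theorem parentTree_adj_parent (hρ : ∀ i, i ≠ r → ρ (f i) < ρ i) {i : ι} (hi : i ≠ r) :
    (parentTree r f).Adj i (f i) := by
  refine (SimpleGraph.fromRel_adj _ _ _).2 ⟨fun h => ?_, Or.inl ⟨hi, rfl⟩⟩
  exact (hρ i hi).ne (congrArg ρ h.symm)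

theorem parentTree_connected (hρ : ∀ i, i ≠ r → ρ (f i) < ρ i) : (parentTree r f).Connected := by
  have hreach : ∀ i, (parentTree r f).Reachable i r := fun i =>
    (exists_walk_of_parent (P := fun _ => True)
      (fun i _ hi => ⟨parentTree_adj_parent hρ hi, hρ i hi, trivial⟩) i trivial).nonempty
  exact (SimpleGraph.connected_iff _).2 ⟨fun i j => (hreach i).trans (hreach j).symm, ⟨r⟩⟩

theorem card_edgeSet_parentTree_lt [Finite ι] (hρ : ∀ i, i ≠ r → ρ (f i) < ρ i) :
    Nat.card (parentTree r f).edgeSet < Nat.card ι := by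
  have hsurj : Function.Surjective fun i : {i // i ≠ r} =>
      (⟨s(i.1, f i.1), parentTree_adj_parent hρ i.2⟩ : (parentTree r f).edgeSet) := by
    rintro ⟨e, he⟩
    induction e with
    | _ i j =>
      obtain ⟨_, ⟨hi, rfl⟩ | ⟨hj, rfl⟩⟩ : i ≠ j ∧ ((i ≠ r ∧ j = f i) ∨ (j ≠ r ∧ i = f j)) := he
      · exact ⟨⟨i, hi⟩, rfl⟩
      · exact ⟨⟨j, hj⟩, Subtype.ext Sym2.eq_swap⟩
  exact (Nat.card_le_card_of_surjective _ hsurj).trans_lt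
    (Finite.card_subtype_lt (x := r) (by simp))

theorem parentTree_isTree [Finite ι] (hρ : ∀ i, i ≠ r → ρ (f i) < ρ i) :
    (parentTree r f).IsTree :=
  SimpleGraph.isTree_iff_connected_and_card.2 ⟨parentTree_connected hρ,
    le_antisymm (card_edgeSet_parentTree_lt hρ)
      (parentTree_connected hρ).card_vert_le_card_edgeSet_add_one⟩

end Trees

section TreeDecompositions

variable {V W ι : Type*} {G : SimpleGraph V} {H : SimpleGraph W}

theorem exists_treeDecomposition_of_isTree [Finite ι] {T : SimpleGraph ι} (hT : T.IsTree)
    {B : ι → Finset V} {w : ℕ} (hvertex : ∀ v, ∃ i, v ∈ B i)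
    (hedge : ∀ u v, G.Adj u v → ∃ i, u ∈ B i ∧ v ∈ B i)
    (hwalk : ∀ v i l, v ∈ B i → v ∈ B l → ∃ q : T.Walk i l, ∀ j ∈ q.support, v ∈ B j)
    (hcard : ∀ i, (B i).card ≤ w + 1) : ∃ D : TreeDecomposition G, D.width ≤ w := by
  let e := Finite.equivFin ι
  let iso := SimpleGraph.Iso.map e T
  refine ⟨⟨Nat.card ι, T.map e.toEmbedding, fun i => B (e.symm i), iso.isTree_iff.1 hT,
    fun v => ?_, fun u v huv => ?_, fun i j l p hp hj v hi hl => ?_⟩, ?_⟩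
  · obtain ⟨i, hi⟩ := hvertex v
    exact ⟨e i, by simpa using hi⟩
  · obtain ⟨i, hi⟩ := hedge u v huv
    exact ⟨e i, by simpa using hi⟩
  · obtain ⟨q, hq⟩ := hwalk v _ _ hi hl
    have hpath : (p.map iso.symm.toHom).IsPath := hp.map iso.symm.injective
    refine hq _ (support_subset_of_isAcyclic hT.isAcyclic hpath q ?_)
    rw [SimpleGraph.Walk.support_map]
    exact List.mem_map_of_mem hj
  · exact Nat.sub_le_iff_le_add.2 (Finset.sup_le fun i _ => hcard _)

/-- `bag u` consists of `u` and the ancestors of `u` it has to remember, and `f` is the parent map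
of the tree: whatever lies in a bag is remembered on the whole way up to its own node. -/
theorem exists_treeDecomposition_of_parent [Finite V] {r : V} {f : V → V} {ρ : V → ℕ}
    {bag : V → Finset V} {w : ℕ} (hρ : ∀ v, v ≠ r → ρ (f v) < ρ v) (hself : ∀ v, v ∈ bag v)
    (hclimb : ∀ u v, v ∈ bag u → u ≠ v → u ≠ r ∧ v ∈ bag (f u))
    (hadj : ∀ u v, G.Adj u v → v ∈ bag u ∨ u ∈ bag v) (hcard : ∀ v, (bag v).card ≤ w + 1) :
    ∃ D : TreeDecomposition G, D.width ≤ w := by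
  refine exists_treeDecomposition_of_isTree (parentTree_isTree hρ) (fun v => ⟨v, hself v⟩)
    (fun u v huv => ?_) (fun v i l hi hl => ?_) hcard
  · exact (hadj u v huv).elim (fun h => ⟨u, hself u, h⟩) fun h => ⟨v, h, hself v⟩
  · have hwalk := exists_walk_of_parent (T := parentTree r f) (P := fun u => v ∈ bag u) (t := v)
      fun u hu huv => ⟨parentTree_adj_parent hρ (hclimb u v hu huv).1,
        hρ u (hclimb u v hu huv).1, (hclimb u v hu huv).2⟩
    obtain ⟨p, hp⟩ := hwalk i hi
    obtain ⟨q, hq⟩ := hwalk l hl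
    refine ⟨p.append q.reverse, fun j hj => ?_⟩
    rw [SimpleGraph.Walk.mem_support_append_iff, SimpleGraph.Walk.support_reverse,
      List.mem_reverse] at hj
    exact hj.elim (hp j) (hq j)

theorem TreeDecomposition.exists_bag_of_triangle (D : TreeDecomposition G) {a b c : V}
    (hab : G.Adj a b) (hbc : G.Adj b c) (hac : G.Adj a c) :
    ∃ m, a ∈ D.bag m ∧ b ∈ D.bag m ∧ c ∈ D.bag m := by
  obtain ⟨i, hia, hib⟩ := D.cover_edge a b hab
  obtain ⟨j, hjb, hjc⟩ := D.cover_edge b c hbc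
  obtain ⟨l, hla, hlc⟩ := D.cover_edge a c hac
  obtain ⟨m, p, q, q', ⟨hp, hmp⟩, ⟨hq, hmq⟩, hq', hmq'⟩ :=
    exists_median_of_connected D.isTree.connected i j l
  exact ⟨m, D.path_inter l m i q hq hmq a hla hia, D.path_inter i m j p hp hmp b hib hjb,
    D.path_inter l m j q' hq' hmq' c hlc hjc⟩

theorem TreeDecomposition.two_le_width_of_triangle (D : TreeDecomposition G) {a b c : V}
    (hab : G.Adj a b) (hbc : G.Adj b c) (hac : G.Adj a c) : 2 ≤ D.width := by
  classical
  obtain ⟨m, ha, hb, hc⟩ := D.exists_bag_of_triangle hab hbc hac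
  have hthree : 3 ≤ (D.bag m).card := by
    rw [← Finset.card_eq_three.2 ⟨a, b, c, hab.ne, hac.ne, hbc.ne, rfl⟩]
    simp [Finset.card_le_card, Finset.insert_subset_iff, ha, hb, hc]
  exact Nat.le_sub_one_of_lt
    (hthree.trans (Finset.le_sup (f := fun i => (D.bag i).card) (Finset.mem_univ m)))

theorem treewidth_eq_two_of_triangle {a b c : V} (hab : G.Adj a b) (hbc : G.Adj b c)
    (hac : G.Adj a c) (h : ∃ D : TreeDecomposition G, D.width ≤ 2) : treewidth G = 2 := by
  obtain ⟨D, hD⟩ := h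
  have hmem : D.width ∈ {w | ∃ D : TreeDecomposition G, D.width = w} := ⟨D, rfl⟩
  refine le_antisymm ((Nat.sInf_le hmem).trans hD) (le_csInf ⟨_, hmem⟩ ?_)
  rintro w ⟨D', rfl⟩
  exact D'.two_le_width_of_triangle hab hbc hac

/-- The transport of a tree decomposition along a graph isomorphism. -/
def TreeDecomposition.congr (e : G ≃g H) (D : TreeDecomposition G) : TreeDecomposition H where
  size := D.size
  tree := D.tree
  bag i := (D.bag i).map e.toEquiv.toEmbedding
  isTree := D.isTree
  cover_vertex v := by
    obtain ⟨i, hi⟩ := D.cover_vertex (e.symm v)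
    exact ⟨i, Finset.mem_map.2 ⟨_, hi, e.apply_symm_apply v⟩⟩
  cover_edge u v h := by
    obtain ⟨i, hu, hv⟩ := D.cover_edge (e.symm u) (e.symm v) (e.symm.map_adj_iff.2 h)
    exact ⟨i, Finset.mem_map.2 ⟨_, hu, e.apply_symm_apply u⟩,
      Finset.mem_map.2 ⟨_, hv, e.apply_symm_apply v⟩⟩
  path_inter i j l p hp hj v hi hl := by
    obtain ⟨u, hu, rfl⟩ := Finset.mem_map.1 hi
    exact Finset.mem_map_of_mem _ (D.path_inter i j l p hp hj u hu ((Finset.mem_map' _).1 hl))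

theorem TreeDecomposition.width_congr (e : G ≃g H) (D : TreeDecomposition G) :
    (D.congr e).width = D.width := by
  simp only [TreeDecomposition.width, TreeDecomposition.congr, Finset.card_map]
  rfl

theorem treewidth_congr (e : G ≃g H) : treewidth G = treewidth H := by
  refine congrArg sInf (Set.ext fun w => ⟨?_, ?_⟩)
  · rintro ⟨D, rfl⟩
    exact ⟨D.congr e, D.width_congr e⟩
  · rintro ⟨D, rfl⟩
    exact ⟨D.congr e.symm, D.width_congr e.symm⟩

end TreeDecompositions

section PatternTreewidth

/-- The rank of a triangle vertex in the order that makes `patternGraph k` a subgraph of a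
`2`-tree: the cycle through the four bridge ends and the four path ends comes first, then the third
vertices of the triangles. A vertex of higher rank is attached later, so `(0, 0, 1)` is the
root. -/
def triangleRank : Fin 2 × Fin 2 × Fin 3 → ℕ
  | (0, 0, 1) => 0
  | (1, 0, 1) => 1
  | (1, 0, 0) => 2
  | (1, 1, 0) => 3
  | (1, 1, 1) => 4
  | (0, 1, 1) => 5
  | (0, 1, 0) => 6
  | (0, 0, 0) => 7
  | _ => 8

/-- The last neighbour of smaller rank of a triangle vertex in the `2`-tree; the root is its own
parent. -/
def triangleParent : Fin 2 × Fin 2 × Fin 3 → Fin 2 × Fin 2 × Fin 3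
  | (0, 0, 1) => (0, 0, 1)
  | (1, 0, 1) => (0, 0, 1)
  | (1, 0, 0) => (1, 0, 1)
  | (1, 1, 0) => (1, 0, 0)
  | (1, 1, 1) => (1, 1, 0)
  | (0, 1, 1) => (1, 1, 1)
  | (0, 1, 0) => (0, 1, 1)
  | (0, 0, 0) => (0, 1, 0)
  | (1, 1, 2) => (1, 1, 1)
  | (s, i, _) => (s, i, 0)

/-- The other neighbour of smaller rank of a triangle vertex in the `2`-tree, with the root as the
value where there is none. -/
def triangleCoparent : Fin 2 × Fin 2 × Fin 3 → Fin 2 × Fin 2 × Fin 3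
  | (1, 1, 2) => (1, 1, 0)
  | (s, i, 2) => (s, i, 1)
  | _ => (0, 0, 1)

variable {k : ℕ}

/-- The extension of `triangleRank` to the pattern graph: the paths are attached after the
triangles. -/
def patternRank : PatternVertex k → ℕ
  | .inl a => triangleRank a
  | .inr (_, _, q) => 9 + q

/-- The extension of `triangleParent` to the pattern graph: the parent of an inner node of a path
is its predecessor. The first inner nodes are attached to the edges `(0, 0, 1) (1, 0, 1)` and
`(1, 1, 1) (0, 1, 1)` of the `2`-tree. -/
def patternParent : PatternVertex k → PatternVertex k
  | .inl a => .inl (triangleParent a)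
  | .inr (i, p, q) =>
      if q = 0 then (if i = 0 then .inl (1, 0, 1) else .inl (0, 1, 1)) else .inr (i, p, q - 1)

/-- The extension of `triangleCoparent` to the pattern graph: all inner nodes of a path have the
end of the path on side `B` in their bag, apart from the first one for `i = 0`, which already has
it as its parent. -/
def patternCoparent : PatternVertex k → PatternVertex k
  | .inl a => .inl (triangleCoparent a)
  | .inr (i, _, q) =>
      if i = 0 then (if q = 0 then .inl (0, 0, 1) else .inl (1, 0, 1)) else .inl (1, 1, 1)

/-- The bag of `v` in a tree decomposition of the pattern graph along `patternParent`. -/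
def patternBag (v : PatternVertex k) : Finset (PatternVertex k) :=
  {v, patternParent v, patternCoparent v}

theorem mem_patternBag {u v : PatternVertex k} :
    v ∈ patternBag u ↔ v = u ∨ v = patternParent u ∨ v = patternCoparent u := by
  simp [patternBag]

theorem patternRank_patternParent_lt (v : PatternVertex k) (hv : v ≠ .inl (0, 0, 1)) :
    patternRank (patternParent v) < patternRank v := by
  have htriangle : ∀ a, a ≠ (0, 0, 1) → triangleRank (triangleParent a) < triangleRank a := by
    decide
  obtain a | ⟨i, p, q⟩ := v
  · exact htriangle a fun h => hv (congrArg _ h)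
  · fin_cases i <;> fin_cases q <;> simp [patternParent, patternRank, triangleRank]

theorem patternCoparent_mem_patternBag_patternParent (v : PatternVertex k) :
    patternCoparent v ∈ patternBag (patternParent v) := by
  have htriangle : ∀ a, triangleCoparent a = triangleParent a ∨
      triangleCoparent a = triangleParent (triangleParent a) ∨
      triangleCoparent a = triangleCoparent (triangleParent a) := by
    decide
  rw [mem_patternBag]
  obtain a | ⟨i, p, q⟩ := v
  · simpa only [patternParent, patternCoparent, Sum.inl.injEq] using htriangle a
  · fin_cases i <;> fin_cases q <;>
      simp [patternParent, patternCoparent, triangleParent, triangleCoparent]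

theorem mem_patternBag_patternParent {u v : PatternVertex k} (h : v ∈ patternBag u)
    (huv : u ≠ v) : u ≠ .inl (0, 0, 1) ∧ v ∈ patternBag (patternParent u) := by
  rw [mem_patternBag, or_iff_right huv.symm] at h
  refine ⟨?_, ?_⟩
  · rintro rfl
    exact h.elim huv.symm huv.symm
  · obtain rfl | rfl := h
    exacts [mem_patternBag.2 (Or.inl rfl), patternCoparent_mem_patternBag_patternParent u]

theorem mem_patternBag_or_of_patternRel {u v : PatternVertex k} (h : patternRel k u v) :
    v ∈ patternBag u ∨ u ∈ patternBag v := by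
  have htriangle : ∀ s i l s' i' l',
      (s = s' ∧ i = i' ∧ l ≠ l') ∨ (s = s' ∧ i ≠ i' ∧ l = 0 ∧ l' = 0) →
      ((s', i', l') = (s, i, l) ∨ (s', i', l') = triangleParent (s, i, l) ∨
        (s', i', l') = triangleCoparent (s, i, l)) ∨
      ((s, i, l) = (s', i', l') ∨ (s, i, l) = triangleParent (s', i', l') ∨
        (s, i, l) = triangleCoparent (s', i', l')) := by
    decide
  rw [mem_patternBag, mem_patternBag]
  obtain ⟨s, i, l⟩ | ⟨i, p, q⟩ := u <;> obtain ⟨s', i', l'⟩ | ⟨i', p', q'⟩ := v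
  · simpa only [patternParent, patternCoparent, Sum.inl.injEq] using htriangle s i l s' i' l' h
  · obtain ⟨rfl, rfl, ⟨rfl, rfl⟩ | ⟨rfl, rfl⟩⟩ := h <;> fin_cases i <;>
      simp [patternParent, patternCoparent]
  · exact h.elim
  · obtain ⟨rfl, rfl, h⟩ := h
    have hq' : q' ≠ 0 := by
      rintro rfl
      simp at h
    have hq : q = q' - 1 := by
      fin_cases q' <;> fin_cases q <;> simp at h ⊢
    simp [patternParent, hq', hq]

theorem treewidth_patternGraph (k : ℕ) : treewidth (patternGraph k) = 2 := by
  refine treewidth_eq_two_of_triangle (a := .inl (0, 0, 0)) (b := .inl (0, 0, 1))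
    (c := .inl (0, 0, 2)) (by simp [patternGraph, patternRel])
    (by simp [patternGraph, patternRel]) (by simp [patternGraph, patternRel]) ?_
  refine exists_treeDecomposition_of_parent patternRank_patternParent_lt
    (fun v => mem_patternBag.2 (Or.inl rfl)) (fun u v => mem_patternBag_patternParent)
    (fun u v h => ?_) (fun v => Finset.card_le_three)
  obtain h | h := ((SimpleGraph.fromRel_adj _ _ _).1 h).2
  exacts [mem_patternBag_or_of_patternRel h, (mem_patternBag_or_of_patternRel h).symm]

end PatternTreewidth

/-! ## Degeneracy -/

section Degeneracy

variable {V W : Type*} {G : SimpleGraph V} {d : ℕ}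

theorem isDegenerate_iff : IsDegenerate G d ↔ ∀ S : Finset V, S.Nonempty →
    ∃ v ∈ S, ∀ N ⊆ S, (∀ w ∈ N, G.Adj v w) → N.card ≤ d := by
  classical
  refine forall₂_congr fun S _ => exists_congr fun v => and_congr_right fun _ => ⟨?_, fun h => ?_⟩
  · exact fun h N hNS hN => le_trans
      (Finset.card_le_card fun w hw => Finset.mem_filter.2 ⟨hNS hw, hN w hw⟩) h
  · exact h _ (Finset.filter_subset _ _) fun w hw => (Finset.mem_filter.1 hw).2

theorem isDegenerate_of_rank {α : Type*} [LinearOrder α] (ρ : V → α)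
    (h : ∀ v, ∃ N : Finset V, N.card ≤ d ∧ ∀ w, G.Adj v w → ρ v ≤ ρ w → w ∈ N) :
    IsDegenerate G d := by
  refine isDegenerate_iff.2 fun S hS => ?_
  obtain ⟨v, hv, hmin⟩ := S.exists_min_image ρ hS
  obtain ⟨N, hN, hmem⟩ := h v
  exact ⟨v, hv, fun N' hN'S hN' => (Finset.card_le_card fun w hw =>
    hmem w (hN' w hw) (hmin w (hN'S hw))).trans hN⟩

theorem IsDegenerate.map (h : IsDegenerate G d) (e : V ↪ W) : IsDegenerate (G.map e) d := by
  refine isDegenerate_iff.2 fun S hS => ?_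
  obtain hempty | hne := (S.preimage e e.injective.injOn).eq_empty_or_nonempty
  · obtain ⟨v, hv⟩ := hS
    refine ⟨v, hv, fun N _ hN => ?_⟩
    have hNempty : N = ∅ := Finset.eq_empty_of_forall_notMem fun w hw => by
      obtain ⟨a, _, _, rfl, _⟩ := (SimpleGraph.map_adj _ _ _ _).1 (hN w hw)
      exact Finset.notMem_empty a (hempty ▸ Finset.mem_preimage.2 hv)
    simp [hNempty]
  · obtain ⟨v, hv, hcard⟩ := isDegenerate_iff.1 h _ hne
    refine ⟨e v, Finset.mem_preimage.1 hv, fun N hNS hN => ?_⟩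
    have hrange : ∀ w ∈ N, ∃ b, G.Adj v b ∧ e b = w := fun w hw => by
      obtain ⟨a, b, hab, ha, hb⟩ := (SimpleGraph.map_adj _ _ _ _).1 (hN w hw)
      exact ⟨b, e.injective ha ▸ hab, hb⟩
    have hmap : N = (N.preimage e e.injective.injOn).map e := by
      grind [Finset.mem_preimage]
    rw [hmap, Finset.card_map]
    refine hcard _ (fun w hw => ?_) fun w hw => ?_
    · exact Finset.mem_preimage.2 (hNS (Finset.mem_preimage.1 hw))
    · obtain ⟨b, hvb, hb⟩ := hrange (e w) (Finset.mem_preimage.1 hw)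
      exact e.injective hb ▸ hvb

theorem IsDegenerate.le_of_isNClique (h : IsDegenerate G d) {m : ℕ} {s : Finset V}
    (hs : G.IsNClique (m + 1) s) : m ≤ d := by
  classical
  obtain ⟨v, hv, hcard⟩ := isDegenerate_iff.1 h s (Finset.card_pos.1 (by simp [hs.card_eq]))
  calc m = (s.erase v).card := by rw [Finset.card_erase_of_mem hv, hs.card_eq, Nat.add_sub_cancel]
    _ ≤ d := hcard _ (Finset.erase_subset v s) fun w hw => hs.isClique hv
        (Finset.mem_of_mem_erase hw) (Finset.ne_of_mem_erase hw).symm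

theorem degeneracy_eq_of_isNClique (h : IsDegenerate G d) {s : Finset V}
    (hs : G.IsNClique (d + 1) s) : degeneracy G = d :=
  le_antisymm (Nat.sInf_le h) (le_csInf ⟨d, h⟩ fun _ hd => hd.le_of_isNClique hs)

end Degeneracy

/-! ## The host graphs -/

/-- The vertices of the host graphs. The words `w : Fin k → Fin r` are the elements of the universe
of the set disjointness instance. There is a triangle `tri s i w` for each word and each of the four
triangles of the pattern, and its second node is joined through the subdivision nodes `sub s i w p`
to the hubs `hub s i p (w p)`, from which the word can be read off. The two parties own the sides
`s = 0` and `s = 1`. -/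
inductive HostVertex (k r : ℕ) : Type
  | tri (s i : Fin 2) (w : Fin k → Fin r) (l : Fin 3)
  | sub (s i : Fin 2) (w : Fin k → Fin r) (p : Fin k)
  | hub (s i : Fin 2) (p : Fin k) (a : Fin r)

namespace HostVertex

variable {k r : ℕ}

/-- The party that owns a vertex. -/
def side : HostVertex k r → Fin 2
  | tri s _ _ _ => s
  | sub s _ _ _ => s
  | hub s _ _ _ => s

/-- The host vertices as a sum of finite types, for counting them. -/
def equivSum (k r : ℕ) : HostVertex k r ≃
    (Fin 2 × Fin 2 × (Fin k → Fin r) × Fin 3) ⊕ (Fin 2 × Fin 2 × (Fin k → Fin r) × Fin k) ⊕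
      (Fin 2 × Fin 2 × Fin k × Fin r) where
  toFun
    | tri s i w l => .inl (s, i, w, l)
    | sub s i w p => .inr (.inl (s, i, w, p))
    | hub s i p a => .inr (.inr (s, i, p, a))
  invFun
    | .inl (s, i, w, l) => tri s i w l
    | .inr (.inl (s, i, w, p)) => sub s i w p
    | .inr (.inr (s, i, p, a)) => hub s i p a
  left_inv := by rintro (_ | _ | _) <;> rfl
  right_inv := by rintro (_ | _ | _) <;> rfl

noncomputable instance (k r : ℕ) : Fintype (HostVertex k r) :=
  Fintype.ofEquiv _ (equivSum k r).symm

theorem card_le (hk : 1 ≤ k) (r : ℕ) : Fintype.card (HostVertex k r) ≤ (12 + 8 * k) * r ^ k := by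
  rw [Fintype.card_congr (equivSum k r)]
  simp only [Fintype.card_sum, Fintype.card_prod, Fintype.card_fin, Fintype.card_fun]
  have hr : k * r ≤ k * r ^ k := Nat.mul_le_mul_left k (Nat.le_self_pow (by omega) r)
  linarith

end HostVertex

section HostGraphs

open HostVertex

variable {k r : ℕ} {X : Fin 2 → (Fin k → Fin r) → Bool}

/-- The adjacency relation of `hostGraph X`. -/
def HostAdj (X : Fin 2 → (Fin k → Fin r) → Bool) : HostVertex k r → HostVertex k r → Prop
  | tri s i w l, tri s' i' w' l' =>
      s = s' ∧ w = w' ∧ ((i = i' ∧ l ≠ l') ∨ (i ≠ i' ∧ l = 0 ∧ l' = 0 ∧ X s w = true))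
  | tri s i w l, sub s' i' w' _ => s = s' ∧ i = i' ∧ w = w' ∧ l = 1
  | sub s i w _, tri s' i' w' l' => s = s' ∧ i = i' ∧ w = w' ∧ l' = 1
  | sub s i w p, hub s' i' p' a => s = s' ∧ i = i' ∧ p = p' ∧ a = w p
  | hub s i p a, sub s' i' w' p' => s = s' ∧ i = i' ∧ p = p' ∧ a = w' p'
  | hub s i p a, hub s' i' p' a' => s ≠ s' ∧ i = i' ∧ p = p' ∧ a = a'
  | _, _ => False

/-- The host graph of the sets `X 0` and `X 1`, given by their indicator functions: the party `s`
joins its two triangles of index `w` by a bridge if and only if `w` lies in `X s`. -/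
def hostGraph (X : Fin 2 → (Fin k → Fin r) → Bool) : SimpleGraph (HostVertex k r) where
  Adj := HostAdj X
  symm := ⟨by rintro (_ | _ | _) (_ | _ | _) <;> grind [HostAdj]⟩
  loopless := ⟨by rintro (_ | _ | _) <;> simp [HostAdj]⟩

theorem fin_two_ne_iff {s t : Fin 2} : s ≠ t ↔ t = s + 1 := by
  omega

theorem hostGraph_adj_tri_iff {s i : Fin 2} {w : Fin k → Fin r} {l : Fin 3} {v : HostVertex k r} :
    (hostGraph X).Adj (tri s i w l) v ↔ (∃ l', l ≠ l' ∧ v = tri s i w l') ∨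
      (l = 0 ∧ X s w = true ∧ v = tri s (i + 1) w 0) ∨ (l = 1 ∧ ∃ p, v = sub s i w p) := by
  cases v <;> simp [hostGraph, HostAdj, fin_two_ne_iff] <;> tauto

theorem hostGraph_adj_sub_iff {s i : Fin 2} {w : Fin k → Fin r} {p : Fin k}
    {v : HostVertex k r} :
    (hostGraph X).Adj (sub s i w p) v ↔ v = tri s i w 1 ∨ v = hub s i p (w p) := by
  cases v <;> simp [hostGraph, HostAdj] <;> tauto

theorem hostGraph_adj_hub_iff {s i : Fin 2} {p : Fin k} {a : Fin r} {v : HostVertex k r} :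
    (hostGraph X).Adj (hub s i p a) v ↔
      (∃ w, w p = a ∧ v = sub s i w p) ∨ v = hub (s + 1) i p a := by
  obtain _ | ⟨s', i', w, p'⟩ | _ := v
  · simp [hostGraph, HostAdj]
  · simp only [hostGraph, HostAdj, sub.injEq, reduceCtorEq, or_false]
    constructor
    · rintro ⟨rfl, rfl, rfl, rfl⟩
      exact ⟨w, rfl, rfl, rfl, rfl, rfl⟩
    · rintro ⟨w, rfl, rfl, rfl, rfl, rfl⟩
      exact ⟨rfl, rfl, rfl, rfl⟩
  · simp [hostGraph, HostAdj, fin_two_ne_iff]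
    tauto

/-- A rank on the vertices of the host graphs for which each vertex has at most two neighbours that
do not rank below it. -/
def hostRank : HostVertex k r → ℕ
  | sub _ _ _ _ => 0
  | tri _ _ _ l => 3 - l
  | hub _ _ _ _ => 4

theorem isDegenerate_hostGraph (X : Fin 2 → (Fin k → Fin r) → Bool) :
    IsDegenerate (hostGraph X) 2 := by
  classical
  refine isDegenerate_of_rank hostRank fun v => ?_
  obtain ⟨s, i, w, l⟩ | ⟨s, i, w, p⟩ | ⟨s, i, p, a⟩ := v
  · fin_cases l
    · refine ⟨{tri s (i + 1) w 0}, by simp, fun u hu hle => ?_⟩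
      obtain ⟨l', hne, rfl⟩ | ⟨-, -, rfl⟩ | ⟨h, -⟩ := hostGraph_adj_tri_iff.1 hu
      · simp [hostRank] at hle hne; omega
      · simp
      · simp at h
    · refine ⟨{tri s i w 0}, by simp, fun u hu hle => ?_⟩
      obtain ⟨l', hne, rfl⟩ | ⟨h, -⟩ | ⟨-, p, rfl⟩ := hostGraph_adj_tri_iff.1 hu
      · fin_cases l' <;> simp [hostRank] at hle hne ⊢
      · simp at h
      · simp [hostRank] at hle
    · refine ⟨{tri s i w 0, tri s i w 1}, Finset.card_le_two, fun u hu hle => ?_⟩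
      obtain ⟨l', hne, rfl⟩ | ⟨h, -⟩ | ⟨h, -⟩ := hostGraph_adj_tri_iff.1 hu
      · fin_cases l' <;> simp at hne ⊢
      · simp at h
      · simp at h
  · exact ⟨{tri s i w 1, hub s i p (w p)}, Finset.card_le_two, fun u hu _ => by
      simpa using hostGraph_adj_sub_iff.1 hu⟩
  · refine ⟨{hub (s + 1) i p a}, by simp, fun u hu hle => ?_⟩
    obtain ⟨w, -, rfl⟩ | rfl := hostGraph_adj_hub_iff.1 hu
    · simp [hostRank] at hle
    · simp

theorem degeneracy_map_hostGraph (X : Fin 2 → (Fin k → Fin r) → Bool) (w : Fin k → Fin r)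
    {V : Type*} (e : HostVertex k r ↪ V) : degeneracy ((hostGraph X).map e) = 2 := by
  classical
  have hadj (l l' : Fin 3) (h : l ≠ l') :
      ((hostGraph X).map e).Adj (e (tri 0 0 w l)) (e (tri 0 0 w l')) :=
    SimpleGraph.map_adj_apply.2 (hostGraph_adj_tri_iff.2 (.inl ⟨l', h, rfl⟩))
  exact degeneracy_eq_of_isNClique ((isDegenerate_hostGraph X).map e)
    (SimpleGraph.is3Clique_triple_iff.2
      ⟨hadj 0 1 (by decide), hadj 0 2 (by decide), hadj 1 2 (by decide)⟩)

/-- The copy of the pattern at the word `w`. -/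
def hostCopy (w : Fin k → Fin r) : PatternVertex k → HostVertex k r
  | .inl (s, i, l) => tri s i w l
  | .inr (i, p, 0) => sub 0 i w p
  | .inr (i, p, 1) => hub 0 i p (w p)
  | .inr (i, p, 2) => hub 1 i p (w p)
  | .inr (i, p, 3) => sub 1 i w p

theorem hostCopy_injective (w : Fin k → Fin r) : Function.Injective (hostCopy w) := by
  rintro (⟨s, i, l⟩ | ⟨i, p, q⟩) (⟨s', i', l'⟩ | ⟨i', p', q'⟩) h
  · simpa [hostCopy] using h
  · fin_cases q' <;> simp [hostCopy] at h
  · fin_cases q <;> simp [hostCopy] at h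
  · fin_cases q <;> fin_cases q' <;> simp [hostCopy] at h ⊢ <;> grind

theorem hostGraph_adj_hostCopy_iff {w : Fin k → Fin r} (hw : ∀ s, X s w = true)
    {u v : PatternVertex k} :
    (hostGraph X).Adj (hostCopy w u) (hostCopy w v) ↔ (patternGraph k).Adj u v := by
  obtain ⟨s, i, l⟩ | ⟨i, p, q⟩ := u <;> obtain ⟨s', i', l'⟩ | ⟨i', p', q'⟩ := v
  · simp [hostGraph, HostAdj, hostCopy, patternGraph, patternRel, hw]
    grind
  · fin_cases q' <;> simp [hostGraph, HostAdj, hostCopy, patternGraph, patternRel] <;> grind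
  · fin_cases q <;> simp [hostGraph, HostAdj, hostCopy, patternGraph, patternRel] <;> grind
  · fin_cases q <;> fin_cases q' <;>
      simp [hostGraph, HostAdj, hostCopy, patternGraph, patternRel] <;> grind

theorem patternGraph_isIndContained_hostGraph {w : Fin k → Fin r} (hw : ∀ s, X s w = true) :
    (patternGraph k).IsIndContained (hostGraph X) :=
  ⟨⟨⟨hostCopy w, hostCopy_injective w⟩, hostGraph_adj_hostCopy_iff hw⟩⟩

theorem eq_tri_of_triangle {u v v' : HostVertex k r} (huv : (hostGraph X).Adj u v)
    (hvv' : (hostGraph X).Adj v v') (huv' : (hostGraph X).Adj u v') :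
    ∃ s i w l₁ l₂ l₃, u = tri s i w l₁ ∧ v = tri s i w l₂ ∧ v' = tri s i w l₃ := by
  obtain ⟨s, i, w, l₁⟩ | _ | _ := u <;> obtain ⟨_, i', _, l₂⟩ | _ | _ := v <;>
    obtain ⟨_, i'', _, l₃⟩ | _ | _ := v' <;>
    simp only [hostGraph, HostAdj] at huv hvv' huv' <;> try omega
  obtain ⟨rfl, rfl, huv⟩ := huv
  obtain ⟨rfl, rfl, hvv'⟩ := hvv'
  obtain ⟨rfl, rfl⟩ : i = i' ∧ i = i'' := by omega
  exact ⟨s, i, w, l₁, l₂, l₃, rfl, rfl, rfl⟩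

theorem range_eq_range_tri_of_triangle {a : Fin 3 → HostVertex k r}
    (ha : ∀ l l', l ≠ l' → (hostGraph X).Adj (a l) (a l')) :
    ∃ s i w, Set.range a = Set.range (tri s i w) := by
  obtain ⟨s, i, w, l₁, l₂, l₃, h₁, h₂, h₃⟩ := eq_tri_of_triangle (ha 0 1 (by decide))
    (ha 1 2 (by decide)) (ha 0 2 (by decide))
  have hσ : ∃ σ : Fin 3 → Fin 3, a = tri s i w ∘ σ :=
    ⟨![l₁, l₂, l₃], funext fun l => by fin_cases l <;> assumption⟩
  obtain ⟨σ, rfl⟩ := hσ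
  have hinj : Function.Injective σ := fun l l' h => by
    by_contra hne
    exact (ha l l' hne).ne (congrArg (tri s i w) h)
  exact ⟨s, i, w, (Finite.injective_iff_surjective.1 hinj).range_comp _⟩

theorem exists_bridge_of_copy (φ : SimpleGraph.Copy (patternGraph k) (hostGraph X)) (s i : Fin 2) :
    ∃ s' i' w, X s' w = true ∧ φ (.inl (s, i, 0)) = tri s' i' w 0 ∧
      Set.range (fun l => φ (.inl (s, i, l))) = Set.range (tri s' i' w) := by
  have hφ := φ.injective
  have htri (j l l') (h : l ≠ l') :
      (hostGraph X).Adj (φ (.inl (s, j, l))) (φ (.inl (s, j, l'))) :=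
    φ.toHom.map_adj (by simp [patternGraph, patternRel, h])
  have hbridge : (hostGraph X).Adj (φ (.inl (s, i, 0))) (φ (.inl (s, i + 1, 0))) :=
    φ.toHom.map_adj (by simp [patternGraph, patternRel])
  obtain ⟨s', i', w, hrange⟩ := range_eq_range_tri_of_triangle (htri i)
  obtain ⟨t, j, v, hrange'⟩ := range_eq_range_tri_of_triangle (htri (i + 1))
  obtain ⟨l, hl⟩ : φ (.inl (s, i, 0)) ∈ Set.range (tri s' i' w) := hrange ▸ ⟨0, rfl⟩
  obtain ⟨l', hl'⟩ : φ (.inl (s, i + 1, 0)) ∈ Set.range (tri t j v) := hrange' ▸ ⟨0, rfl⟩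
  rw [← hl] at hbridge
  obtain ⟨m, -, hm⟩ | ⟨rfl, hX, -⟩ | ⟨-, p, hp⟩ := hostGraph_adj_tri_iff.1 hbridge
  · obtain ⟨m', hm'⟩ : φ (.inl (s, i + 1, 0)) ∈ Set.range fun l => φ (.inl (s, i, l)) :=
      hrange ▸ ⟨m, hm.symm⟩
    simpa using hφ hm'
  · exact ⟨s', i', w, hX, hl.symm, hrange⟩
  · simp [← hl'] at hp

theorem exists_hub_of_copy (hk : 1 ≤ k) (φ : SimpleGraph.Copy (patternGraph k) (hostGraph X))
    {s i : Fin 2} {q q' : Fin 4}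
    (hq : ∀ p, (patternGraph k).Adj (.inl (s, i, 1)) (.inr (i, p, q)))
    (hq' : ∀ p, (patternGraph k).Adj (.inr (i, p, q)) (.inr (i, p, q'))) :
    ∃ s' i' w, ∃ π : Fin k → Fin k, Function.Injective π ∧ X s' w = true ∧
      ∀ p, φ (.inr (i, p, q')) = hub s' i' (π p) (w (π p)) := by
  have hφ := φ.injective
  obtain ⟨s', i', w, hX, h0, hrange⟩ := exists_bridge_of_copy φ s i
  obtain ⟨l, hl⟩ : φ (.inl (s, i, 1)) ∈ Set.range (tri s' i' w) := hrange ▸ ⟨1, rfl⟩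
  have hsub (p) : l = 1 ∧ ∃ p', φ (.inr (i, p, q)) = sub s' i' w p' := by
    obtain ⟨m, -, hm⟩ | ⟨rfl, -, -⟩ | h := hostGraph_adj_tri_iff.1 (hl ▸ φ.toHom.map_adj (hq p))
    · obtain ⟨m', hm'⟩ : φ (.inr (i, p, q)) ∈ Set.range fun l => φ (.inl (s, i, l)) :=
        hrange ▸ ⟨m, hm.symm⟩
      simpa using hφ hm'
    · simpa using hφ (h0.trans hl)
    · exact h
  choose π hπ using fun p => (hsub p).2
  refine ⟨s', i', w, π, fun p p' h => ?_, hX, fun p => ?_⟩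
  · simpa using hφ (((hπ p).trans (congrArg _ h)).trans (hπ p').symm)
  · obtain h | h := hostGraph_adj_sub_iff.1 (hπ p ▸ φ.toHom.map_adj (hq' p))
    · obtain ⟨rfl, -⟩ := hsub ⟨0, hk⟩
      simpa using hφ (h.trans hl)
    · exact h

theorem exists_of_patternGraph_isContained_hostGraph (hk : 1 ≤ k)
    (h : (patternGraph k).IsContained (hostGraph X)) : ∃ w, ∀ s, X s w = true := by
  obtain ⟨φ⟩ := h
  obtain ⟨s, i, w, π, hπ, hw, hhub⟩ := exists_hub_of_copy hk φ (s := 0) (i := 0) (q := 0) (q' := 1)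
    (by simp [patternGraph, patternRel]) (by simp [patternGraph, patternRel])
  obtain ⟨s', i', w', π', -, hw', hhub'⟩ :=
    exists_hub_of_copy hk φ (s := 1) (i := 0) (q := 3) (q' := 2)
      (by simp [patternGraph, patternRel]) (by simp [patternGraph, patternRel])
  have hmid (p) : s ≠ s' ∧ i = i' ∧ π p = π' p ∧ w (π p) = w' (π' p) := by
    have hadj : (hostGraph X).Adj (φ (.inr (0, p, 1))) (φ (.inr (0, p, 2))) :=
      φ.toHom.map_adj (by simp [patternGraph, patternRel])
    rwa [hhub, hhub'] at hadj
  have hww' : w = w' := funext fun p => by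
    obtain ⟨q, rfl⟩ := Finite.injective_iff_surjective.1 hπ p
    obtain ⟨-, -, hπq, hwq⟩ := hmid q
    rw [hwq, hπq]
  refine ⟨w, fun t => ?_⟩
  obtain rfl | rfl : t = s ∨ t = s' := by have := (hmid ⟨0, hk⟩).1; omega
  exacts [hw, hww' ▸ hw']

theorem hostGraph_adj_congr {X' : Fin 2 → (Fin k → Fin r) → Bool} {u v : HostVertex k r}
    (h : X u.side = X' u.side) : (hostGraph X).Adj u v ↔ (hostGraph X').Adj u v := by
  cases u <;> cases v <;> simp_all [hostGraph, HostAdj, side]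

theorem eq_hub_of_adj_of_side_ne {u v : HostVertex k r} (h : (hostGraph X).Adj u v)
    (hs : u.side ≠ v.side) : ∃ s i p a, u = hub s i p a ∧ v = hub (s + 1) i p a := by
  cases u with
  | tri => obtain ⟨_, -, rfl⟩ | ⟨-, -, rfl⟩ | ⟨-, _, rfl⟩ := hostGraph_adj_tri_iff.1 h <;>
      simp [side] at hs
  | sub => obtain rfl | rfl := hostGraph_adj_sub_iff.1 h <;> simp [side] at hs
  | hub s i p a =>
    obtain ⟨_, -, rfl⟩ | rfl := hostGraph_adj_hub_iff.1 h
    · simp [side] at hs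
    · exact ⟨s, i, p, a, rfl, rfl⟩

end HostGraphs

/-! ## Elementary estimates -/

theorem exists_nat_pow_le_lt_succ_pow {k : ℕ} (hk : 1 ≤ k) {y : ℝ} (hy : 0 ≤ y) :
    ∃ r : ℕ, (r : ℝ) ^ k ≤ y ∧ y < (r + 1 : ℝ) ^ k := by
  have hroot : (y ^ (k : ℝ)⁻¹) ^ k = y := Real.rpow_inv_natCast_pow hy (by omega)
  have hroot0 : 0 ≤ y ^ (k : ℝ)⁻¹ := by positivity
  refine ⟨⌊y ^ (k : ℝ)⁻¹⌋₊, ?_, ?_⟩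
  · exact (pow_le_pow_left₀ (by positivity) (Nat.floor_le hroot0) k).trans_eq hroot
  · exact hroot.symm.trans_lt (pow_lt_pow_left₀ (Nat.lt_floor_add_one _) hroot0 (by omega))

theorem rpow_one_sub_inv_le_of_le_mul_pow {m : ℕ} {x q y : ℝ} (hx : 0 ≤ x) (hq : 1 ≤ q) (hy : 0 ≤ y)
    (h : x ≤ q * y ^ (m + 1)) : x ^ (1 - 1 / ((m + 1 : ℕ) : ℝ)) ≤ q * y ^ m := by
  have hexp : ((m + 1 : ℕ) : ℝ) * (1 - 1 / ((m + 1 : ℕ) : ℝ)) = (m : ℝ) := by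
    field_simp
    push_cast
    ring
  have hexp0 : 0 ≤ 1 - 1 / ((m + 1 : ℕ) : ℝ) := by
    rw [← mul_nonneg_iff_of_pos_left (c := ((m + 1 : ℕ) : ℝ)) (by positivity), hexp]
    positivity
  calc x ^ (1 - 1 / ((m + 1 : ℕ) : ℝ))
      ≤ (q * y ^ (m + 1)) ^ (1 - 1 / ((m + 1 : ℕ) : ℝ)) := Real.rpow_le_rpow hx h hexp0
    _ = q ^ (1 - 1 / ((m + 1 : ℕ) : ℝ)) * y ^ m := by
      rw [Real.mul_rpow (by positivity) (by positivity), ← Real.rpow_natCast y (m + 1),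
        ← Real.rpow_mul hy, hexp, Real.rpow_natCast]
    _ ≤ q * y ^ m := by
      gcongr
      refine (Real.rpow_le_rpow_of_exponent_le hq ?_).trans_eq (Real.rpow_one q)
      exact sub_le_self 1 (by positivity)

theorem exists_forall_rpow_le_of_le_mul_log {α β C c : ℝ} (hαβ : α < β) (hc : 0 < c) :
    ∃ c' : ℝ, 0 < c' ∧ ∀ x b t : ℝ, 1 ≤ x → 0 ≤ t → b ≤ C * Real.log x →
      c * x ^ β ≤ b * t → c' * x ^ α ≤ t := by
  set ε := β - α with hε
  have hε0 : 0 < ε := sub_pos.2 hαβ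
  set D := max C 1
  have hD0 : 0 < D := lt_of_lt_of_le one_pos (le_max_right _ _)
  refine ⟨c * ε / D, by positivity, fun x b t hx ht hb h => ?_⟩
  have hx0 : 0 < x := by linarith
  have hbD : b ≤ D * (x ^ ε / ε) :=
    calc b ≤ C * Real.log x := hb
      _ ≤ D * Real.log x := mul_le_mul_of_nonneg_right (le_max_left _ _) (Real.log_nonneg hx)
      _ ≤ D * (x ^ ε / ε) := mul_le_mul_of_nonneg_left (Real.log_le_rpow_div hx0.le hε0) hD0.le
  refine le_of_mul_le_mul_right (a := D / ε * x ^ ε) ?_ (by positivity)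
  calc c * ε / D * x ^ α * (D / ε * x ^ ε) = c * (x ^ α * x ^ ε) := by field_simp
    _ = c * x ^ β := by rw [← Real.rpow_add hx0, hε, add_sub_cancel]
    _ ≤ b * t := h
    _ ≤ D * (x ^ ε / ε) * t := mul_le_mul_of_nonneg_right hbD ht
    _ = t * (D / ε * x ^ ε) := by ring

theorem pow_le_mul_of_pow_succ_le {m r : ℕ} {x : ℝ} (hr : 2304 ≤ r)
    (h : (r : ℝ) ^ (m + 1) ≤ 1152 * (8 * (m + 1 : ℕ) * r * x + 1)) :
    (r : ℝ) ^ m ≤ 18432 * (m + 1 : ℕ) * x := by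
  -- Since `1152 ≤ r ^ (m + 1) / 2`, the additive constant is absorbed by the left-hand side of `h`.
  have hr' : (2304 : ℝ) ≤ r := by exact_mod_cast hr
  have hpow : (2304 : ℝ) ≤ (r : ℝ) ^ (m + 1) := hr'.trans (le_self_pow₀ (by linarith) (by omega))
  refine le_of_mul_le_mul_right (a := (r : ℝ)) ?_ (by linarith)
  rw [← pow_succ]
  linarith

/-! ## The lower bound -/

theorem isContained_of_isContained_map {W V V' : Type*} {H : SimpleGraph W} {G : SimpleGraph V}
    (e : V ↪ V') (hH : ∀ u, ∃ v, H.Adj u v) (h : H.IsContained (G.map e)) : H.IsContained G := by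
  obtain ⟨φ⟩ := h
  have hrange (u) : ∃ a, e a = φ u := by
    obtain ⟨v, hv⟩ := hH u
    obtain ⟨a, _, _, ha, _⟩ := (SimpleGraph.map_adj _ _ _ _).1 (φ.toHom.map_adj hv)
    exact ⟨a, ha⟩
  choose ψ hψ using hrange
  have hinj : Function.Injective (e ∘ ψ) := (funext hψ : e ∘ ψ = φ) ▸ φ.injective
  refine ⟨⟨⟨ψ, fun {u v} huv => ?_⟩, hinj.of_comp⟩⟩
  rw [← SimpleGraph.map_adj_apply (f := e), hψ, hψ]
  exact φ.toHom.map_adj huv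

theorem patternGraph_exists_adj (k : ℕ) (u : PatternVertex k) : ∃ v, (patternGraph k).Adj u v := by
  obtain ⟨s, i, l⟩ | ⟨i, p, q⟩ := u
  · refine ⟨.inl (s, i, l + 1), ?_⟩
    fin_cases l <;> simp [patternGraph, patternRel]
  · refine ⟨.inr (i, p, if q = 0 then 1 else q - 1), ?_⟩
    fin_cases q <;> simp [patternGraph, patternRel]

section Reduction

variable {k r n b T : ℕ}

theorem exists_of_patternGraph_isContained_map {V : Type*} {X : Fin 2 → (Fin k → Fin r) → Bool}
    (hk : 1 ≤ k) {e : HostVertex k r ↪ V}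
    (h : (patternGraph k).IsContained ((hostGraph X).map e)) : ∃ w, ∀ s, X s w = true :=
  exists_of_patternGraph_isContained_hostGraph hk
    (isContained_of_isContained_map e (patternGraph_exists_adj k) h)

theorem patternGraph_isIndContained_map {V : Type*} {X : Fin 2 → (Fin k → Fin r) → Bool}
    {w : Fin k → Fin r} (hw : ∀ s, X s w = true) (e : HostVertex k r ↪ V) :
    (patternGraph k).IsIndContained ((hostGraph X).map e) :=
  (patternGraph_isIndContained_hostGraph hw).trans ⟨SimpleGraph.Embedding.map e _⟩

theorem patternGraph_isContained_map_iff {V : Type*} {X : Fin 2 → (Fin k → Fin r) → Bool}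
    (hk : 1 ≤ k) (e : HostVertex k r ↪ V) :
    (patternGraph k).IsContained ((hostGraph X).map e) ↔ ∃ w, ∀ s, X s w = true :=
  ⟨exists_of_patternGraph_isContained_map hk,
    fun ⟨_, hw⟩ => (patternGraph_isIndContained_map hw e).isContained⟩

theorem patternGraph_isIndContained_map_iff {V : Type*} {X : Fin 2 → (Fin k → Fin r) → Bool}
    (hk : 1 ≤ k) (e : HostVertex k r ↪ V) :
    (patternGraph k).IsIndContained ((hostGraph X).map e) ↔ ∃ w, ∀ s, X s w = true :=
  ⟨fun h => exists_of_patternGraph_isContained_map hk h.isContained,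
    fun ⟨_, hw⟩ => patternGraph_isIndContained_map hw e⟩

theorem not_disjoint_iff_exists_forall_fin_two {ι : Type*} {x y : ι → Bool} :
    ¬ Disjoint x y ↔ ∃ w, ∀ s, (![x, y] : Fin 2 → ι → Bool) s w = true := by
  simp [disjoint_iff, funext_iff, Fin.forall_fin_two]

theorem map_hostGraph_adj_congr {V : Type*} {X X' : Fin 2 → (Fin k → Fin r) → Bool}
    (e : HostVertex k r ↪ V) {v : V} (h : ∀ a, e a = v → X a.side = X' a.side) (u : V) :
    ((hostGraph X).map e).Adj v u ↔ ((hostGraph X').map e).Adj v u := by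
  simp only [SimpleGraph.map_adj]
  refine exists₂_congr fun a c => ?_
  constructor <;> rintro ⟨hac, ha, hc⟩
  · exact ⟨(hostGraph_adj_congr (h a ha)).1 hac, ha, hc⟩
  · exact ⟨(hostGraph_adj_congr (h a ha)).2 hac, ha, hc⟩

/-- The host graphs on the nodes `Fin n` as networks for two players, the owners of the sides `0`
and `1`. Only edges between hubs cross the cut. -/
noncomputable def hostNetwork (e : HostVertex k r ↪ Fin n) :
    TwoPartyNetwork ((Fin k → Fin r) → Bool) ((Fin k → Fin r) → Bool) n where
  graph x y := (hostGraph ![x, y]).map e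
  side := e '' {v | v.side = 0}
  cut := Finset.univ.image fun c : Fin 2 × Fin 2 × Fin k × Fin r =>
    (e (.hub c.1 c.2.1 c.2.2.1 c.2.2.2), e (.hub (c.1 + 1) c.2.1 c.2.2.1 c.2.2.2))
  adj_left x y y' v hv := by
    obtain ⟨a, ha, rfl⟩ := hv
    refine map_hostGraph_adj_congr e fun a' ha' => ?_
    rw [e.injective ha', show a.side = 0 from ha]
    rfl
  adj_right x x' y v hv := by
    refine map_hostGraph_adj_congr e fun a ha => ?_
    have hside : a.side = 1 := by
      have : a.side ≠ 0 := fun h => hv ⟨a, h, ha⟩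
      omega
    rw [hside]
    rfl
  mem_cut x y u v huv hiff := by
    obtain ⟨a, c, hac, rfl, rfl⟩ := (SimpleGraph.map_adj _ _ _ _).1 huv
    rw [e.injective.mem_set_image, e.injective.mem_set_image] at hiff
    have hside : a.side ≠ c.side := by
      intro h
      simp only [Set.mem_ofPred_eq, h] at hiff
      tauto
    obtain ⟨s, i, p, m, rfl, rfl⟩ := eq_hub_of_adj_of_side_ne hac hside
    exact Finset.mem_image.2 ⟨(s, i, p, m), Finset.mem_univ _, rfl⟩

theorem card_cut_hostNetwork_le (e : HostVertex k r ↪ Fin n) :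
    (hostNetwork e).cut.card ≤ 4 * k * r := by
  refine Finset.card_image_le.trans_eq ?_
  simp only [Finset.card_univ, Fintype.card_prod, Fintype.card_fin]
  ring

theorem pow_le_of_randSolvable {P : SimpleGraph (Fin n) → Prop} (hr : 1 ≤ r)
    (e : HostVertex k r ↪ Fin n)
    (hP : ∀ X : Fin 2 → (Fin k → Fin r) → Bool,
      P ((hostGraph X).map e) ↔ ∃ w, ∀ s, X s w = true)
    (h : RandSolvable b T (fun G => degeneracy G = 2) P) :
    (r : ℝ) ^ k ≤ 1152 * (8 * k * r * (b * T) + 1) := by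
  have hcut : ((hostNetwork e).cut.card : ℝ) ≤ 4 * k * r := by
    exact_mod_cast card_cut_hostNetwork_le e
  calc (r : ℝ) ^ k = Fintype.card (Fin k → Fin r) := by simp
    _ ≤ 1152 * (2 * (hostNetwork e).cut.card * (b * T) + 1) :=
      (hostNetwork e).card_le_of_randSolvable
        (fun x y => degeneracy_map_hostGraph ![x, y] (fun _ => ⟨0, hr⟩) e)
        (fun x y => (hP ![x, y]).trans not_disjoint_iff_exists_forall_fin_two.symm) h
    _ ≤ 1152 * (2 * (4 * k * r) * (b * T) + 1) := by gcongr
    _ = 1152 * (8 * k * r * (b * T) + 1) := by ring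

theorem pow_le_of_detectable (hk : 1 ≤ k) (hr : 1 ≤ r) (e : HostVertex k r ↪ Fin n)
    (h : DetectableOnDegeneracyTwo (patternGraph k) n b T) :
    (r : ℝ) ^ k ≤ 1152 * (8 * k * r * (b * T) + 1) := by
  have hcont (X : Fin 2 → (Fin k → Fin r) → Bool) := patternGraph_isContained_map_iff (X := X) hk e
  have hind (X : Fin 2 → (Fin k → Fin r) → Bool) :=
    patternGraph_isIndContained_map_iff (X := X) hk e
  obtain h | h | h | h := h
  · exact pow_le_of_randSolvable hr e hcont h.randSolvable
  · exact pow_le_of_randSolvable hr e hind h.randSolvable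
  · exact pow_le_of_randSolvable hr e hcont h
  · exact pow_le_of_randSolvable hr e hind h

end Reduction

theorem exists_detection_lower_bound {k : ℕ} (hk : 1 ≤ k) :
    ∃ c : ℝ, 0 < c ∧ ∃ n₀ : ℕ, ∀ n : ℕ, n₀ ≤ n → ∀ b T : ℕ,
      DetectableOnDegeneracyTwo (patternGraph k) n b T →
        c * (n : ℝ) ^ (1 - 1 / (k : ℝ)) ≤ (b : ℝ) * (T : ℝ) := by
  obtain ⟨m, rfl⟩ : ∃ m, k = m + 1 := ⟨k - 1, by omega⟩
  set q : ℕ := 12 + 8 * (m + 1)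
  have hq0 : (0 : ℝ) < q := by positivity
  refine ⟨1 / (q * 2 ^ m * (18432 * (m + 1 : ℕ))), by positivity, q * 2305 ^ (m + 1), ?_⟩
  intro n hn b T h
  obtain ⟨r, hrle, hrlt⟩ := exists_nat_pow_le_lt_succ_pow hk (show 0 ≤ (n / q : ℝ) by positivity)
  rw [le_div_iff₀ hq0, mul_comm] at hrle
  rw [div_lt_iff₀' hq0] at hrlt
  have hr : 2304 ≤ r := by
    have hlt : q * 2305 ^ (m + 1) < q * (r + 1) ^ (m + 1) :=
      lt_of_le_of_lt hn (by exact_mod_cast hrlt)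
    have := lt_of_pow_lt_pow_left₀ _ (by omega) (lt_of_mul_lt_mul_left hlt (by omega))
    omega
  have hcard : Fintype.card (HostVertex (m + 1) r) ≤ Fintype.card (Fin n) :=
    (HostVertex.card_le hk r).trans (by rw [Fintype.card_fin]; exact_mod_cast hrle)
  obtain ⟨e⟩ := Function.Embedding.nonempty_of_card_le hcard
  have hrm := pow_le_mul_of_pow_succ_le hr (pow_le_of_detectable hk (by omega) e h)
  have hr1 : (1 : ℝ) ≤ r := by exact_mod_cast (show 1 ≤ r by omega)
  have hq1 : (1 : ℝ) ≤ q := by exact_mod_cast (show 1 ≤ q by omega)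
  rw [one_div, inv_mul_le_iff₀ (by positivity)]
  calc (n : ℝ) ^ (1 - 1 / ((m + 1 : ℕ) : ℝ)) ≤ q * (r + 1) ^ m :=
        rpow_one_sub_inv_le_of_le_mul_pow (by positivity) hq1 (by positivity) hrlt.le
    _ ≤ q * (2 * r) ^ m := by gcongr; linarith
    _ = q * 2 ^ m * (r : ℝ) ^ m := by ring
    _ ≤ q * 2 ^ m * (18432 * (m + 1 : ℕ) * (b * T)) := by gcongr
    _ = q * 2 ^ m * (18432 * (m + 1 : ℕ)) * (b * T) := by ring

theorem DetectableOnDegeneracyTwo.congr {W W' : Type} {H : SimpleGraph W} {H' : SimpleGraph W'}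
    (e : H ≃g H') {n b T : ℕ} (h : DetectableOnDegeneracyTwo H n b T) :
    DetectableOnDegeneracyTwo H' n b T := by
  have hcont (G : SimpleGraph (Fin n)) : H.IsContained G ↔ H'.IsContained G :=
    SimpleGraph.isContained_congr_left e
  have hind (G : SimpleGraph (Fin n)) : H.IsIndContained G ↔ H'.IsIndContained G :=
    ⟨fun ⟨f⟩ => ⟨f.comp e.symm.toEmbedding⟩, fun ⟨f⟩ => ⟨f.comp e.toEmbedding⟩⟩
  simpa only [DetectableOnDegeneracyTwo, hcont, hind] using h

/-- For each `k ≥ 2`: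
* the pattern graph with `k` paths has treewidth `2`, and detecting it, induced or not, with
  bandwidth `b` on graphs of degeneracy `2` needs at least `c * n ^ (1 - 1/k) / b` rounds;
* for some pattern of treewidth `2`, with bandwidth `O(log n)` even `Ω(n ^ (1 - 1/k))` rounds
  are needed. -/
theorem mainTheorem8 (k : ℕ) (hk : 2 ≤ k) :
    (treewidth (patternGraph k) = 2 ∧
      ∃ c : ℝ, 0 < c ∧ ∃ n₀ : ℕ, ∀ n : ℕ, n₀ ≤ n → ∀ b T : ℕ,
        DetectableOnDegeneracyTwo (patternGraph k) n b T →
          c * (n : ℝ) ^ (1 - 1 / (k : ℝ)) ≤ (b : ℝ) * (T : ℝ)) ∧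
    (∃ (m : ℕ) (H : SimpleGraph (Fin m)), treewidth H = 2 ∧
      ∀ C : ℝ, ∃ c : ℝ, 0 < c ∧ ∃ n₀ : ℕ, ∀ n : ℕ, n₀ ≤ n → ∀ b T : ℕ,
        (b : ℝ) ≤ C * Real.log n → DetectableOnDegeneracyTwo H n b T →
          c * (n : ℝ) ^ (1 - 1 / (k : ℝ)) ≤ (T : ℝ)) := by
  refine ⟨⟨treewidth_patternGraph k, exists_detection_lower_bound (by omega)⟩, ?_⟩
  let e := SimpleGraph.Iso.map (Fintype.equivFin (PatternVertex (k + 1))) (patternGraph (k + 1))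
  refine ⟨_, _, (treewidth_congr e).symm.trans (treewidth_patternGraph _), fun C => ?_⟩
  obtain ⟨c₁, hc₁, n₁, hn₁⟩ := exists_detection_lower_bound (k := k + 1) (by omega)
  have hexp : 1 - 1 / (k : ℝ) < 1 - 1 / ((k + 1 : ℕ) : ℝ) :=
    sub_lt_sub_left (one_div_lt_one_div_of_lt (by positivity) (by exact_mod_cast k.lt_succ_self)) 1
  obtain ⟨c, hc, hrounds⟩ := exists_forall_rpow_le_of_le_mul_log (C := C) hexp hc₁
  refine ⟨c, hc, max n₁ 1, fun n hn b T hb h => ?_⟩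
  exact hrounds n b T (by exact_mod_cast le_of_max_le_right hn) T.cast_nonneg hb
    (hn₁ n (le_of_max_le_left hn) b T (h.congr e.symm))
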